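/- Let $n\ge 0$, let $C=\mathbb C[x_1,\dots,x_n]/I$ be the coinvariant algebra, where $I$ is generated by the homogeneous symmetric polynomials of positive degree, and let $S_n$ act on $C$ by permuting the $x_j$. A composition of $n$ is a tuple $\nu=(\nu_i)_{i\in\mathbb Z}$ of non-negative integers with sum $n$. Let $X_i=\{x_j : \sum_{h<i}\nu_h<j\le\sum_{h\le i}\nu_h\}$, let $S_\nu\subseteq S_n$ be the parabolic subgroup preserving every $X_i$, and let $e_r(\nu;i)$ and $h_r(\nu;i)$ be the $r$th elementary and complete symmetric polynomials in the variables $X_i$ ($h_r=0$ for $r<0$). For compositions $\nu,\nu'$ put $C_\nu=C^{S_\nu}$ and $C_{\nu,\nu'}=C^{S_\nu\cap S_{\nu'}}$. These are the cohomology algebras of the corresponding partial flag manifolds. *Push-forward.* For $H=1$, $S_\nu$ or $S_\nu\cap S_{\nu'}$, the class of a point in $C^H$ is the image of $\frac{|H|}{n!}\prod(x_i-x_j)$, the product being over the pairs $i<j$ in different $H$-orbits. There is a unique linear functional $\int_H:C^H\to\mathbb C$ that sends the class of a point to $1$ and vanishes on all graded components of $C^H$ other than the one containing this class, and the Poincaré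 duality map $C^H\to (C^H)^*$, $z\mapsto(y\mapsto \int_H zy)$, is an isomorphism. For $K\le H$ among these groups, the pull-back $C^H\to C^K$ is the inclusion, and the push-forward $q_*:C^K\to C^H$ is the transpose of the pull-back (the push-forward in homology) conjugated by Poincaré duality; that is, $\int_H q_*(z)\,y=\int_K z\,y$ for all $z\in C^K$, $y\in C^H$. *The action.* Let $\widehat{\mathfrak g}=\mathfrak{gl}_\infty(\mathbb C)$ be the Lie algebra of $\mathbb Z\times\mathbb Z$ matrices with finitely many non-zero entries, with natural module $\widehat V=\bigoplus_{i\in\mathbb Z}\mathbb C v_i$, and let $E_i$ and $F_i$ be the matrix units in positions $(i,i+1)$ and $(i+1,i)$. Let $\widetilde C$ be $C$ with the $S_n$-action twisted by sign, and $\widetilde C_\nu=\widetilde C^{S_\nu}$. Let $$\varphi:\widehat V^{\otimes n}\otimes_{\mathbb CS_n}\widetilde C\to\textstyle\bigoplus_\nu C_\nu$$ (sum over all compositions $\nu$ of $n$) be the composite of the map $\kappa:\widehat V^{\otimes n}\otimes_{\mathbb CS_n}\widetilde C\to\bigoplus_\nu\widetilde C_\nu$, given by $v_{a_1}\otimes\cdots\otimes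 v_{a_n}\otimes m\mapsto\frac1{|S_\nu|}\sum_{w\in S_\nu}wm\in\widetilde C_\nu$ if $a_1\le\dots\le a_n$ and exactly $\nu_i$ of the $a_j$ equal $i$ for each $i$, with the direct sum of the restrictions $\widetilde C_\nu\to C_\nu$ of the push-forwards $\pi_*:C\to C_\nu$. Then $\varphi$ is bijective. Use it to transport the natural action of $\widehat{\mathfrak g}$ on $\widehat V^{\otimes n}\otimes_{\mathbb CS_n}\widetilde C$ to $\bigoplus_\nu C_\nu$. **Theorem.** Let $i\in\mathbb Z$, let $\nu$ be a composition of $n$ with $\nu_i\ne0$, and let $\nu'$ be obtained from $\nu$ by replacing $\nu_i$ by $\nu_i-1$ and $\nu_{i+1}$ by $\nu_{i+1}+1$. Put $a=\nu_i'=\nu_i-1$, $b=\nu_{i+1}=\nu'_{i+1}-1$ and $k=\sum_{j\le i}\nu_j$. Let $p^*:C_\nu\to C_{\nu,\nu'}$ and $(p')^*:C_{\nu'}\to C_{\nu,\nu'}$ be the pull-backs, and $p_*:C_{\nu,\nu'}\to C_\nu$ and $p'_*:C_{\nu,\nu'}\to C_{\nu'}$ the push-forwards. (i) $F_i$ maps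 $C_\nu$ to $C_{\nu'}$, and there it equals $p'_*\circ m\circ p^*$, where $m$ is multiplication by $\prod_{j=1}^a(x_{k-j}-x_k)$. Equivalently, it is the restriction to $C_\nu$ of the unique $C_{\nu'}$-module homomorphism $C_{\nu,\nu'}\to C_{\nu'}$ sending $$x_k^r\mapsto(-1)^a\sum_{s=0}^a(-1)^s e_s(\nu';i)\,h_{r-s+a-b}(\nu';i+1)\qquad\text{for each } r\ge0 .$$ (ii) $E_i$ maps $C_{\nu'}$ to $C_\nu$, and there it equals $p_*\circ m'\circ(p')^*$, where $m'$ is multiplication by $\prod_{j=1}^b(x_k-x_{k+j})$. Equivalently, it is the restriction to $C_{\nu'}$ of the unique $C_\nu$-module homomorphism $C_{\nu,\nu'}\to C_\nu$ sending $$x_k^r\mapsto(-1)^a\sum_{s=0}^b(-1)^s e_s(\nu;i+1)\,h_{r-s+b-a}(\nu;i)\qquad\text{for each } r\ge0 .$$ -/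

import Mathlib

open scoped TensorProduct DirectSum

attribute [local instance 100] LieRing.ofAssociativeRing

namespace CoinvGl

noncomputable section

/-! ### Compositions, words and parabolic subgroups -/

/-- A composition of `n`: a tuple `(ν_i)_{i ∈ ℤ}` of non-negative integers summing to `n`. -/
abbrev Comp (n : ℕ) : Type := {ν : ℤ →₀ ℕ // (ν.sum fun _ m => m) = n}

theorem Comp.length_sort {n : ℕ} (ν : Comp n) : (ν.1.toMultiset.sort).length = n := by
  rw [Multiset.length_sort, Finsupp.card_toMultiset]
  exact ν.2

/-- The weakly increasing word `a_1 ≤ ⋯ ≤ a_n` with exactly `ν_i` letters equal to `i`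
(see `word_monotone` and `card_word_eq`). -/
def word {n : ℕ} (ν : Comp n) (j : Fin n) : ℤ :=
  (ν.1.toMultiset.sort).get (j.cast ν.length_sort.symm)

theorem word_monotone {n : ℕ} (ν : Comp n) : Monotone (word ν) := by
  intro j l h
  have := (Multiset.pairwise_sort ν.1.toMultiset (fun a b => a ≤ b)).sortedLE.monotone_get
  exact this (show j.cast ν.length_sort.symm ≤ l.cast ν.length_sort.symm from h)

theorem map_word {n : ℕ} (ν : Comp n) :
    (Finset.univ : Finset (Fin n)).val.map (word ν) = ν.1.toMultiset := by
  have h : List.ofFn (word ν) = ν.1.toMultiset.sort := by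
    apply List.ext_get
    · simp [ν.length_sort]
    · intro k h1 h2
      simp [word]
  have h2 : (Finset.univ : Finset (Fin n)).val.map (word ν) = (List.ofFn (word ν) : Multiset ℤ) := by
    simp [List.ofFn_eq_map, Fin.univ_val_map]
  rw [h2, h, Multiset.sort_eq]

theorem card_word_eq {n : ℕ} (ν : Comp n) (i : ℤ) :
    (Finset.univ.filter fun j => word ν j = i).card = ν.1 i := by
  have := congrArg (Multiset.count i) (map_word ν)
  rw [Finsupp.count_toMultiset, Multiset.count_map] at this
  rw [← this]
  simp only [Finset.card_def, Finset.filter_val, eq_comm]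

/-- The position block `X_i` of a composition. -/
def block {n : ℕ} (ν : Comp n) (i : ℤ) : Finset (Fin n) :=
  Finset.univ.filter fun j => word ν j = i

/-- `ν_{≤ i} = ∑_{h ≤ i} ν_h`. -/
def partialSum {n : ℕ} (ν : Comp n) (i : ℤ) : ℕ := ∑ h ∈ ν.1.support with h ≤ i, ν.1 h

theorem card_word_le {n : ℕ} (ν : Comp n) (i : ℤ) :
    (Finset.univ.filter fun j => word ν j ≤ i).card = partialSum ν i := by
  have hm : ∀ j ∈ Finset.univ.filter (fun j => word ν j ≤ i),
      word ν j ∈ ν.1.support.filter (fun h => h ≤ i) := by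
    intro j hj
    simp only [Finset.mem_filter, Finset.mem_univ, true_and] at hj
    refine Finset.mem_filter.2 ⟨?_, hj⟩
    rw [← Finsupp.mem_toMultiset, ← map_word ν]
    exact Multiset.mem_map_of_mem _ (Finset.mem_univ j)
  rw [Finset.card_eq_sum_card_fiberwise hm, partialSum]
  refine Finset.sum_congr rfl fun h hh => ?_
  rw [← card_word_eq ν h, Finset.filter_filter]
  refine congrArg _ (Finset.filter_congr fun j _ => ?_)
  have := (Finset.mem_filter.1 hh).2
  constructor
  · exact fun h => h.2
  · rintro rfl
    exact ⟨this, rfl⟩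

/-- In the numbering of positions by `0, …, n - 1`, the first `ν_{≤ i}` positions are those of the
blocks `X_h` with `h ≤ i`. So `X_i` consists of the positions `j` with
`ν_{≤ i - 1} ≤ j < ν_{≤ i}`. -/
theorem word_le_iff {n : ℕ} (ν : Comp n) (i : ℤ) (j : Fin n) :
    word ν j ≤ i ↔ (j : ℕ) < partialSum ν i := by
  rw [← card_word_le]
  constructor
  · intro h
    have hs : Finset.Iic j ⊆ Finset.univ.filter fun l => word ν l ≤ i := fun l hl =>
      Finset.mem_filter.2 ⟨Finset.mem_univ _, (word_monotone ν (Finset.mem_Iic.1 hl)).trans h⟩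
    have := Finset.card_le_card hs
    rw [Fin.card_Iic] at this
    omega
  · intro h
    by_contra hn
    have hs : (Finset.univ.filter fun l => word ν l ≤ i) ⊆ Finset.Iio j := fun l hl => by
      rw [Finset.mem_Iio]
      by_contra hl2
      exact hn ((word_monotone ν (not_lt.1 hl2)).trans (Finset.mem_filter.1 hl).2)
    have := Finset.card_le_card hs
    rw [Fin.card_Iio] at this
    omega

theorem mem_block_iff {n : ℕ} (ν : Comp n) (i : ℤ) (j : Fin n) :
    j ∈ block ν i ↔ partialSum ν (i - 1) ≤ j ∧ (j : ℕ) < partialSum ν i := by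
  rw [← word_le_iff, ← not_lt, ← word_le_iff, block, Finset.mem_filter]
  simp only [Finset.mem_univ, true_and]
  omega

/-- The parabolic subgroup `S_ν` of permutations preserving every block `X_i`. -/
def young {n : ℕ} (ν : Comp n) : Subgroup (Equiv.Perm (Fin n)) where
  carrier := {w | ∀ j, word ν (w j) = word ν j}
  mul_mem' := by
    intro u w hu hw j
    rw [Equiv.Perm.mul_apply, hu, hw]
  one_mem' := fun _ => rfl
  inv_mem' := by
    intro w hw j
    have := hw (w⁻¹ j)
    have h2 : w (w⁻¹ j) = j := w.apply_symm_apply j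
    rw [h2] at this
    exact this.symm

/-! ### Coinvariant algebras -/

/-- The ideal generated by the homogeneous symmetric polynomials of positive degree. -/
def symIdeal (n : ℕ) : Ideal (MvPolynomial (Fin n) ℂ) :=
  Ideal.span {f | f.IsSymmetric ∧ ∃ d : ℕ, 0 < d ∧ f.IsHomogeneous d}

/-- The coinvariant algebra `C = ℂ[x_1, …, x_n] / I`. -/
abbrev Coinv (n : ℕ) : Type := MvPolynomial (Fin n) ℂ ⧸ symIdeal n

/-- The canonical quotient map `ℂ[x_1, …, x_n] → C`. -/
def toCoinv (n : ℕ) : MvPolynomial (Fin n) ℂ →ₐ[ℂ] Coinv n := Ideal.Quotient.mkₐ ℂ (symIdeal n)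

theorem symIdeal_le_comap {n : ℕ} (w : Equiv.Perm (Fin n)) :
    symIdeal n ≤ (symIdeal n).comap (MvPolynomial.rename w : _ →ₐ[ℂ] _) := by
  refine Ideal.span_le.2 fun f hf => ?_
  change MvPolynomial.rename w f ∈ symIdeal n
  rw [hf.1 w]
  exact Ideal.subset_span hf

/-- The action of a permutation on `C`, induced by `x_j ↦ x_{w(j)}`. -/
def perm {n : ℕ} (w : Equiv.Perm (Fin n)) : Coinv n →ₐ[ℂ] Coinv n :=
  Ideal.quotientMapₐ (symIdeal n) (MvPolynomial.rename w) (symIdeal_le_comap w)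

theorem perm_toCoinv {n : ℕ} (w : Equiv.Perm (Fin n)) (f : MvPolynomial (Fin n) ℂ) :
    perm w (toCoinv n f) = toCoinv n (MvPolynomial.rename w f) := rfl

theorem perm_mul {n : ℕ} (u w : Equiv.Perm (Fin n)) (x : Coinv n) :
    perm (u * w) x = perm u (perm w x) := by
  obtain ⟨f, rfl⟩ := Ideal.Quotient.mkₐ_surjective ℂ (symIdeal n) x
  change perm _ (toCoinv n f) = perm _ (perm _ (toCoinv n f))
  rw [perm_toCoinv, perm_toCoinv, perm_toCoinv, MvPolynomial.rename_rename]
  rfl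

/-- The sign-twisted action of a permutation on `C`, that is, the action of `w` on `C̃`. -/
def twist {n : ℕ} (w : Equiv.Perm (Fin n)) : Coinv n →ₗ[ℂ] Coinv n :=
  ((Equiv.Perm.sign w : ℤ) : ℂ) • (perm w).toLinearMap

theorem twist_mul {n : ℕ} (u w : Equiv.Perm (Fin n)) (x : Coinv n) :
    twist (u * w) x = twist u (twist w x) := by
  simp [twist, perm_mul, smul_smul, mul_comm]

/-- The subalgebra `C^H` of invariants. For `H = S_ν` this is the partial coinvariant
algebra `C_ν`, and for `H = S_ν ∩ S_ν'` it is `C_{ν,ν'}`. -/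
def inv {n : ℕ} (H : Subgroup (Equiv.Perm (Fin n))) : Subalgebra ℂ (Coinv n) where
  carrier := {x | ∀ w ∈ H, perm w x = x}
  mul_mem' := by
    intro x y hx hy w hw
    rw [map_mul, hx w hw, hy w hw]
  add_mem' := by
    intro x y hx hy w hw
    rw [map_add, hx w hw, hy w hw]
  algebraMap_mem' := fun r w _ => (perm w).commutes r

theorem inv_anti {n : ℕ} {K H : Subgroup (Equiv.Perm (Fin n))} (h : K ≤ H) : inv H ≤ inv K :=
  fun _ hx w hw => hx w (h hw)

/-- The pull-back `C^H → C^K` for `K ≤ H`, which is the inclusion. -/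
def pullback {n : ℕ} {K H : Subgroup (Equiv.Perm (Fin n))} (h : K ≤ H) : inv H →ₐ[ℂ] inv K :=
  Subalgebra.inclusion (inv_anti h)

/-- The space `C̃_ν` of `S_ν`-invariants of `C̃`, i.e. of `S_ν`-anti-invariants in `C`. -/
def antiInv {n : ℕ} (ν : Comp n) : Submodule ℂ (Coinv n) where
  carrier := {x | ∀ w ∈ young ν, twist w x = x}
  add_mem' := by
    intro x y hx hy w hw
    rw [map_add, hx w hw, hy w hw]
  zero_mem' := fun w _ => map_zero _
  smul_mem' := by
    intro c x hx w hw
    rw [map_smul, hx w hw]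

/-! ### Poincaré duality and push-forwards -/

open Classical in
/-- The pairs `i < j` that do not lie in one `H`-orbit. -/
def crossPairs {n : ℕ} (H : Subgroup (Equiv.Perm (Fin n))) : Finset (Fin n × Fin n) :=
  Finset.univ.filter fun p => p.1 < p.2 ∧ p.1 ∉ MulAction.orbit H p.2

/-- The polynomial `ε / ε_H = (|H| / n!) ∏ (x_i - x_j)`, over the pairs `i < j` in different
`H`-orbits; its image in `C^H` is the class of a point. -/
def pointPoly {n : ℕ} (H : Subgroup (Equiv.Perm (Fin n))) : MvPolynomial (Fin n) ℂ :=
  MvPolynomial.C ((Nat.card H : ℂ) / (n.factorial : ℂ)) *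
    ∏ p ∈ crossPairs H, (MvPolynomial.X p.1 - MvPolynomial.X p.2)

/-- `φ` is the integration functional `∫` on the cohomology algebra `C^H`: it sends the class of
a point to `1` and vanishes on all graded components other than the top one (the one that
contains the class of a point). -/
def IsIntegral {n : ℕ} (H : Subgroup (Equiv.Perm (Fin n))) (φ : inv H →ₗ[ℂ] ℂ) : Prop :=
  (∃ x : inv H, (x : Coinv n) = toCoinv n (pointPoly H) ∧ φ x = 1) ∧
  ∀ (d : ℕ) (f : MvPolynomial (Fin n) ℂ), d ≠ (crossPairs H).card → f.IsHomogeneous d →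
    ∀ x : inv H, (x : Coinv n) = toCoinv n f → φ x = 0

open Classical in
/-- The integration functional on `C^H`. (The value `0` is used only if there is none, which
`PoincareDuality H` excludes.) -/
def integral {n : ℕ} (H : Subgroup (Equiv.Perm (Fin n))) : inv H →ₗ[ℂ] ℂ :=
  if h : ∃ φ, IsIntegral H φ then h.choose else 0

/-- The Poincaré duality map from cohomology `C^H` to homology `(C^H)^*`,
`x ↦ (y ↦ ∫ x y)`. -/
def poincare {n : ℕ} (H : Subgroup (Equiv.Perm (Fin n))) :
    inv H →ₗ[ℂ] Module.Dual ℂ (inv H) :=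
  (LinearMap.mul ℂ (inv H)).compr₂ (integral H)

/-- `C^H` has a unique integration functional and the Poincaré duality map is bijective. -/
def PoincareDuality {n : ℕ} (H : Subgroup (Equiv.Perm (Fin n))) : Prop :=
  (∃! φ, IsIntegral H φ) ∧ Function.Bijective (poincare H)

open Classical in
/-- The push-forward `C^K → C^H` for `K ≤ H`: the push-forward `(C^K)^* → (C^H)^*` in homology
(the transpose of the pull-back), conjugated by Poincaré duality. (The value `0` is used only
if `poincare H` is not bijective, which `PoincareDuality H` excludes.) -/
def pushforward {n : ℕ} {K H : Subgroup (Equiv.Perm (Fin n))} (h : K ≤ H) :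
    inv K →ₗ[ℂ] inv H :=
  if hb : Function.Bijective (poincare H) then
    (LinearEquiv.ofBijective (poincare H) hb).symm.toLinearMap ∘ₗ
      (pullback h).toLinearMap.dualMap ∘ₗ poincare K
  else 0

/-- An element of `C`, as an element of the invariants of the trivial group. -/
def toInvBot {n : ℕ} : Coinv n →ₗ[ℂ] inv (⊥ : Subgroup (Equiv.Perm (Fin n))) :=
  LinearMap.codRestrict (Subalgebra.toSubmodule (inv ⊥)) LinearMap.id (by
    intro x w hw
    rw [Subgroup.mem_bot] at hw
    subst hw
    obtain ⟨f, rfl⟩ := Ideal.Quotient.mkₐ_surjective ℂ (symIdeal n) x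
    change perm 1 (toCoinv n f) = toCoinv n f
    rw [perm_toCoinv]
    congr 1
    exact MvPolynomial.rename_id_apply f)

/-- The restriction to `C̃_ν` of the push-forward `π_* : C → C_ν`. -/
def piPush {n : ℕ} (ν : Comp n) : antiInv ν →ₗ[ℂ] inv (young ν) :=
  pushforward (bot_le : ⊥ ≤ young ν) ∘ₗ toInvBot ∘ₗ (antiInv ν).subtype

/-! ### The Lie algebra `gl_∞` and tensor space -/

/-- The natural module, with basis `v_i = single i 1` for `i ∈ ℤ`. -/
abbrev V : Type := ℤ →₀ ℂ

instance instAddCommGroupV : AddCommGroup V := Finsupp.instAddCommGroup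

/-- The matrix units: `matrixUnit i j` sends `v_j` to `v_i` and all other `v_l` to `0`. -/
def matrixUnit (i j : ℤ) : Module.End ℂ V := Finsupp.lsingle i ∘ₗ Finsupp.lapply j

theorem matrixUnit_single (i j l : ℤ) (c : ℂ) :
    matrixUnit i j (Finsupp.single l c) = if l = j then Finsupp.single i c else 0 := by
  by_cases h : l = j
  · simp [matrixUnit, h]
  · simp [matrixUnit, h]

/-- The linear maps `V → V` having all but finitely many matrix entries equal to zero. -/
def HasFiniteMatrix (f : Module.End ℂ V) : Prop :=
  {p : ℤ × ℤ | f (Finsupp.single p.2 1) p.1 ≠ 0}.Finite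

theorem HasFiniteMatrix.add {f g : Module.End ℂ V} (hf : HasFiniteMatrix f)
    (hg : HasFiniteMatrix g) : HasFiniteMatrix (f + g) := by
  refine (hf.union hg).subset fun p hp => ?_
  by_contra h
  simp only [Set.mem_union, Set.mem_ofPred_eq, not_or, not_not] at h
  exact hp (by simp [h.1, h.2])

theorem HasFiniteMatrix.smul (c : ℂ) {f : Module.End ℂ V} (hf : HasFiniteMatrix f) :
    HasFiniteMatrix (c • f) := by
  refine hf.subset fun p hp h => hp ?_
  simp [h]

theorem HasFiniteMatrix.mul {f g : Module.End ℂ V} (hf : HasFiniteMatrix f)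
    (hg : HasFiniteMatrix g) : HasFiniteMatrix (f * g) := by
  refine ((hf.image Prod.fst).prod (hg.image Prod.snd)).subset fun p hp => ?_
  have key : (f * g) (Finsupp.single p.2 1) p.1 =
      (g (Finsupp.single p.2 1)).sum fun l c => c * f (Finsupp.single l 1) p.1 := by
    rw [Module.End.mul_apply]
    conv_lhs => rw [← Finsupp.sum_single (g (Finsupp.single p.2 1))]
    rw [map_finsuppSum, Finsupp.sum_apply]
    refine Finsupp.sum_congr fun l _ => ?_
    rw [← mul_one (g (Finsupp.single p.2 1) l), ← smul_eq_mul, ← Finsupp.smul_single, map_smul]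
    simp
  rw [Set.mem_ofPred_eq, key] at hp
  obtain ⟨l, hl, hne⟩ := Finset.exists_ne_zero_of_sum_ne_zero hp
  refine ⟨⟨(p.1, l), right_ne_zero_of_mul hne, rfl⟩, ⟨(l, p.2), ?_, rfl⟩⟩
  exact left_ne_zero_of_mul hne

theorem hasFiniteMatrix_matrixUnit (i j : ℤ) : HasFiniteMatrix (matrixUnit i j) := by
  refine (Set.finite_singleton (i, j)).subset fun p hp => ?_
  rw [Set.mem_ofPred_eq, matrixUnit_single] at hp
  by_cases h : p.2 = j
  · rw [if_pos h, Finsupp.single_apply] at hp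
    have h1 : i = p.1 := by
      by_contra hne
      exact hp (if_neg hne)
    exact Prod.ext h1.symm h
  · simp [h] at hp

/-- The Lie algebra `gl_∞` of matrices with rows and columns indexed by `ℤ`, all but finitely
many of whose entries are zero, acting on the natural module `V`. -/
def glInf : LieSubalgebra ℂ (Module.End ℂ V) where
  carrier := {f | HasFiniteMatrix f}
  add_mem' := HasFiniteMatrix.add
  zero_mem' := by simp [HasFiniteMatrix]
  smul_mem' := fun c _ hf => hf.smul c
  lie_mem' := by
    intro f g hf hg
    change HasFiniteMatrix _
    rw [Ring.lie_def, sub_eq_add_neg, ← neg_one_smul ℂ (g * f)]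
    exact (hf.mul hg).add ((hg.mul hf).smul _)

/-- The Chevalley generator `E_i`, the `(i, i+1)` matrix unit. -/
def genE (i : ℤ) : glInf := ⟨matrixUnit i (i + 1), hasFiniteMatrix_matrixUnit _ _⟩

/-- The Chevalley generator `F_i`, the `(i+1, i)` matrix unit. -/
def genF (i : ℤ) : glInf := ⟨matrixUnit (i + 1) i, hasFiniteMatrix_matrixUnit _ _⟩

/-- Tensor space `V^{⊗ n}`. -/
abbrev Tens (n : ℕ) : Type := ⨂[ℂ] _ : Fin n, V

instance instAddCommGroupTens (n : ℕ) : AddCommGroup (Tens n) :=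
  PiTensorProduct.instAddCommGroup

/-- The operator `1 ⊗ ⋯ ⊗ X ⊗ ⋯ ⊗ 1` with `X` in the `j`th place. -/
def actAt (n : ℕ) (j : Fin n) : Module.End ℂ V →ₗ[ℂ] Module.End ℂ (Tens n) :=
  (PiTensorProduct.mapMultilinear ℂ (fun _ : Fin n => V) (fun _ => V)).toLinearMap
    (fun _ => 1) j

theorem actAt_apply (n : ℕ) (j : Fin n) (X : Module.End ℂ V) :
    actAt n j X = PiTensorProduct.map (Function.update (fun _ => 1) j X) := rfl

theorem actAt_mul_same (n : ℕ) (j : Fin n) (X Y : Module.End ℂ V) :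
    actAt n j X * actAt n j Y = actAt n j (X * Y) := by
  rw [actAt_apply, actAt_apply, actAt_apply, ← PiTensorProduct.map_mul]
  congr 1
  funext l
  by_cases h : l = j
  · subst h; simp
  · simp [h]

theorem actAt_mul_comm (n : ℕ) {j l : Fin n} (h : j ≠ l) (X Y : Module.End ℂ V) :
    actAt n j X * actAt n l Y = actAt n l Y * actAt n j X := by
  rw [actAt_apply, actAt_apply, ← PiTensorProduct.map_mul, ← PiTensorProduct.map_mul]
  congr 1
  funext m
  by_cases h1 : m = j
  · subst h1; simp [h]
  · simp [h1]

/-- The action of `End V` on tensor space, `X ↦ ∑_j 1 ⊗ ⋯ ⊗ X ⊗ ⋯ ⊗ 1`. -/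
def tensRep (n : ℕ) : Module.End ℂ V →ₗ⁅ℂ⁆ Module.End ℂ (Tens n) where
  toLinearMap := ∑ j, actAt n j
  map_lie' := by
    intro X Y
    change (∑ j, actAt n j) (X * Y - Y * X) =
      (∑ j, actAt n j) X * (∑ j, actAt n j) Y - (∑ j, actAt n j) Y * (∑ j, actAt n j) X
    simp only [LinearMap.sum_apply, Finset.sum_mul_sum, map_sub]
    have h : ∑ j, ∑ l, actAt n j Y * actAt n l X = ∑ j, ∑ l, actAt n l Y * actAt n j X :=
      Finset.sum_comm
    refine Eq.trans ?_ (congrArg (fun z => (∑ j, ∑ l, actAt n j X * actAt n l Y) - z) h.symm)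
    rw [← Finset.sum_sub_distrib, ← Finset.sum_sub_distrib]
    refine Finset.sum_congr rfl fun j _ => ?_
    rw [← Finset.sum_sub_distrib, Finset.sum_eq_single j]
    · rw [actAt_mul_same, actAt_mul_same]
    · intro l _ hl
      rw [actAt_mul_comm n hl.symm, sub_self]
    · simp

/-- The right action of a permutation on tensor space,
`(u_1 ⊗ ⋯ ⊗ u_n) w = u_{w(1)} ⊗ ⋯ ⊗ u_{w(n)}`. -/
def permTens {n : ℕ} (w : Equiv.Perm (Fin n)) : Tens n →ₗ[ℂ] Tens n :=
  (PiTensorProduct.reindex ℂ (fun _ : Fin n => V) w.symm).toLinearMap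

theorem permTens_tprod {n : ℕ} (w : Equiv.Perm (Fin n)) (u : Fin n → V) :
    permTens w (PiTensorProduct.tprod ℂ u) = PiTensorProduct.tprod ℂ fun j => u (w j) := by
  exact PiTensorProduct.reindex_tprod _ _

theorem tensRep_tprod {n : ℕ} (X : Module.End ℂ V) (u : Fin n → V) :
    tensRep n X (PiTensorProduct.tprod ℂ u) =
      ∑ j, PiTensorProduct.tprod ℂ (Function.update u j (X (u j))) := by
  change (∑ j, actAt n j) X _ = _
  simp only [LinearMap.sum_apply]
  refine Finset.sum_congr rfl fun j _ => ?_
  rw [actAt_apply, PiTensorProduct.map_tprod]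
  congr 1
  funext l
  by_cases h : l = j
  · subst h; simp
  · simp [h]

theorem tensRep_permTens {n : ℕ} (X : Module.End ℂ V) (w : Equiv.Perm (Fin n)) (t : Tens n) :
    tensRep n X (permTens w t) = permTens w (tensRep n X t) := by
  suffices h : tensRep n X ∘ₗ permTens w = permTens w ∘ₗ tensRep n X from
    LinearMap.congr_fun h t
  refine PiTensorProduct.ext (MultilinearMap.ext fun u => ?_)
  simp only [LinearMap.compMultilinearMap_apply, LinearMap.comp_apply, permTens_tprod,
    tensRep_tprod, map_sum]
  refine Eq.trans ?_ (Equiv.sum_comp w _)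
  refine Finset.sum_congr rfl fun j _ => ?_
  congr 1
  funext l
  by_cases h : l = j
  · subst h
    rw [Function.update_self, Function.update_self]
  · rw [Function.update_of_ne h, Function.update_of_ne fun h2 => h (w.injective h2)]

/-! ### The module `V^{⊗ n} ⊗_{ℂ S_n} C̃` -/

/-- The relations `t w ⊗ m - t ⊗ w m` defining the tensor product over `ℂ S_n`. -/
def balanced (n : ℕ) : Submodule ℂ (Tens n ⊗[ℂ] Coinv n) :=
  Submodule.span ℂ {z | ∃ (w : Equiv.Perm (Fin n)) (t : Tens n) (m : Coinv n),
    z = permTens w t ⊗ₜ[ℂ] m - t ⊗ₜ[ℂ] twist w m}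

/-- `V^{⊗ n} ⊗_{ℂ S_n} C̃`. -/
abbrev TensCoinv (n : ℕ) : Type := (Tens n ⊗[ℂ] Coinv n) ⧸ balanced n

theorem balanced_le_comap {n : ℕ} (X : Module.End ℂ V) :
    balanced n ≤ (balanced n).comap ((tensRep n X).rTensor (Coinv n)) := by
  refine Submodule.span_le.2 ?_
  rintro _ ⟨w, t, m, rfl⟩
  refine Submodule.subset_span ⟨w, tensRep n X t, m, ?_⟩
  rw [map_sub, LinearMap.rTensor_tmul, LinearMap.rTensor_tmul, tensRep_permTens]

theorem mapQ_comp_mk {n : ℕ} (X : Module.End ℂ V) (z : Tens n ⊗[ℂ] Coinv n) :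
    (balanced n).mapQ (balanced n) ((tensRep n X).rTensor (Coinv n)) (balanced_le_comap X)
      (Submodule.Quotient.mk z) =
      Submodule.Quotient.mk ((tensRep n X).rTensor (Coinv n) z) := rfl

/-- The action of `gl_∞` on `V^{⊗ n} ⊗_{ℂ S_n} C̃`, through the first tensor factor. -/
def tensCoinvRep (n : ℕ) : glInf →ₗ⁅ℂ⁆ Module.End ℂ (TensCoinv n) where
  toFun X := (balanced n).mapQ (balanced n) ((tensRep n X).rTensor (Coinv n))
    (balanced_le_comap X.1)
  map_add' X Y := by
    refine LinearMap.ext fun q => ?_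
    obtain ⟨z, rfl⟩ := Submodule.Quotient.mk_surjective _ q
    rw [LinearMap.add_apply, mapQ_comp_mk, mapQ_comp_mk, mapQ_comp_mk,
      ← Submodule.Quotient.mk_add, ← LinearMap.add_apply, ← LinearMap.rTensor_add]
    simp
  map_smul' c X := by
    refine LinearMap.ext fun q => ?_
    obtain ⟨z, rfl⟩ := Submodule.Quotient.mk_surjective _ q
    rw [RingHom.id_apply, LinearMap.smul_apply, mapQ_comp_mk, mapQ_comp_mk,
      ← Submodule.Quotient.mk_smul, ← LinearMap.smul_apply, ← LinearMap.rTensor_smul]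
    simp
  map_lie' := by
    intro X Y
    refine LinearMap.ext fun q => ?_
    obtain ⟨z, rfl⟩ := Submodule.Quotient.mk_surjective _ q
    rw [Ring.lie_def, LinearMap.sub_apply, Module.End.mul_apply, Module.End.mul_apply,
      mapQ_comp_mk, mapQ_comp_mk, mapQ_comp_mk, mapQ_comp_mk, mapQ_comp_mk,
      ← Submodule.Quotient.mk_sub, LieSubalgebra.coe_bracket, LieHom.map_lie, Ring.lie_def,
      LinearMap.rTensor_sub, LinearMap.rTensor_mul, LinearMap.rTensor_mul]
    rfl

/-! ### The isomorphism `φ` and the action on `⨁ C_ν` -/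

/-- The type (weight) of a word: the composition `ν` with `ν_i` the number of letters `i`. -/
def typ {n : ℕ} (b : Fin n → ℤ) : Comp n :=
  ⟨∑ j, Finsupp.single (b j) 1, by
    have h : ∀ f : ℤ →₀ ℕ, (f.sum fun _ m => m) = f.degree := fun f => rfl
    rw [h, map_sum]
    simp⟩

theorem typ_word {n : ℕ} (ν : Comp n) : typ (word ν) = ν := by
  refine Subtype.ext (Finsupp.ext fun i => ?_)
  rw [← card_word_eq ν i]
  simp [typ, Finsupp.finsetSum_apply, Finsupp.single_apply]

theorem typ_comp {n : ℕ} (b : Fin n → ℤ) (w : Equiv.Perm (Fin n)) :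
    typ (fun j => b (w j)) = typ b := by
  refine Subtype.ext ?_
  exact Equiv.sum_comp w fun j => (Finsupp.single (b j) 1 : ℤ →₀ ℕ)

open Classical in
/-- `m ↦ (1 / |S_ν|) ∑ w m` (twisted action), over the `w` with `v_b = (v_{a_1} ⊗ ⋯ ⊗ v_{a_n}) w`,
where `a` is the increasing word of type `ν`. -/
def kappaWord {n : ℕ} (ν : Comp n) (b : Fin n → ℤ) : Coinv n →ₗ[ℂ] antiInv ν :=
  LinearMap.codRestrict (antiInv ν)
    ((1 / (Nat.card (young ν) : ℂ)) •
      ∑ w : Equiv.Perm (Fin n) with (∀ j, word ν (w j) = b j), twist w) (by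
    intro m u hu
    rw [LinearMap.smul_apply, map_smul, LinearMap.sum_apply, map_sum]
    congr 1
    refine Finset.sum_bij (fun w _ => u * w) ?_ ?_ ?_ ?_
    · intro w hw
      simp only [Finset.mem_filter, Finset.mem_univ, true_and] at hw ⊢
      intro j
      rw [Equiv.Perm.mul_apply, hu, hw]
    · intro w _ w' _ h
      exact mul_left_cancel h
    · intro w hw
      simp only [Finset.mem_filter, Finset.mem_univ, true_and] at hw
      refine ⟨u⁻¹ * w, ?_, by group⟩
      simp only [Finset.mem_filter, Finset.mem_univ, true_and]
      intro j
      rw [Equiv.Perm.mul_apply, (young ν).inv_mem hu, hw]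
    · intro w _
      rw [twist_mul])

open Classical in
theorem coe_kappaWord {n : ℕ} (ν : Comp n) (b : Fin n → ℤ) (m : Coinv n) :
    (kappaWord ν b m : Coinv n) = (1 / (Nat.card (young ν) : ℂ)) •
      ∑ w : Equiv.Perm (Fin n) with (∀ j, word ν (w j) = b j), twist w m := by
  change ((1 / (Nat.card (young ν) : ℂ)) •
      ∑ w : Equiv.Perm (Fin n) with (∀ j, word ν (w j) = b j), twist w) m = _
  rw [LinearMap.smul_apply, LinearMap.sum_apply]

theorem kappaWord_comp {n : ℕ} (ν : Comp n) (b : Fin n → ℤ) (u : Equiv.Perm (Fin n))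
    (m : Coinv n) : kappaWord ν (fun j => b (u j)) m = kappaWord ν b (twist u m) := by
  classical
  refine Subtype.ext ?_
  rw [coe_kappaWord, coe_kappaWord]
  congr 1
  refine Finset.sum_bij (fun w _ => w * u⁻¹) ?_ ?_ ?_ ?_
  · intro w hw
    simp only [Finset.mem_filter, Finset.mem_univ, true_and] at hw ⊢
    intro j
    have h2 : u (u⁻¹ j) = j := u.apply_symm_apply j
    rw [Equiv.Perm.mul_apply, hw, h2]
  · intro w _ w' _ h
    exact mul_right_cancel h
  · intro w hw
    simp only [Finset.mem_filter, Finset.mem_univ, true_and] at hw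
    refine ⟨w * u, ?_, by group⟩
    simp only [Finset.mem_filter, Finset.mem_univ, true_and]
    intro j
    rw [Equiv.Perm.mul_apply, hw]
  · intro w _
    rw [← twist_mul]
    congr 2
    group

/-- The basis `v_{b_1} ⊗ ⋯ ⊗ v_{b_n}` of tensor space. -/
def tensBasis (n : ℕ) : Module.Basis (Fin n → ℤ) ℂ (Tens n) :=
  Basis.piTensorProduct fun _ => Finsupp.basisSingleOne

theorem tensBasis_apply {n : ℕ} (b : Fin n → ℤ) :
    tensBasis n b = PiTensorProduct.tprod ℂ fun j => Finsupp.single (b j) (1 : ℂ) := by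
  rw [tensBasis, Basis.piTensorProduct_apply]
  simp

/-- The map on `V^{⊗ n} ⊗_ℂ C` that induces `κ`. -/
def kappaAux (n : ℕ) : Tens n ⊗[ℂ] Coinv n →ₗ[ℂ] ⨁ ν : Comp n, antiInv ν :=
  TensorProduct.lift ((tensBasis n).constr ℂ fun b =>
    DirectSum.lof ℂ (Comp n) (fun ν => antiInv ν) (typ b) ∘ₗ kappaWord (typ b) b)

theorem kappaAux_tmul {n : ℕ} (b : Fin n → ℤ) (m : Coinv n) :
    kappaAux n (tensBasis n b ⊗ₜ[ℂ] m) =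
      DirectSum.lof ℂ (Comp n) (fun ν => antiInv ν) (typ b) (kappaWord (typ b) b m) := by
  rw [kappaAux, TensorProduct.lift.tmul, Module.Basis.constr_basis]
  rfl

theorem balanced_le_ker (n : ℕ) : balanced n ≤ LinearMap.ker (kappaAux n) := by
  refine Submodule.span_le.2 ?_
  rintro _ ⟨w, t, m, rfl⟩
  rw [SetLike.mem_coe, LinearMap.mem_ker, map_sub, sub_eq_zero]
  suffices h : (kappaAux n).comp ((TensorProduct.mk ℂ (Tens n) (Coinv n)).flip m ∘ₗ permTens w) =
      (kappaAux n).comp ((TensorProduct.mk ℂ (Tens n) (Coinv n)).flip (twist w m)) from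
    LinearMap.congr_fun h t
  refine (tensBasis n).ext fun b => ?_
  have h : permTens w (tensBasis n b) = tensBasis n fun j => b (w j) := by
    rw [tensBasis_apply, permTens_tprod, tensBasis_apply]
  change kappaAux n (permTens w (tensBasis n b) ⊗ₜ[ℂ] m) =
    kappaAux n (tensBasis n b ⊗ₜ[ℂ] twist w m)
  rw [h, kappaAux_tmul, kappaAux_tmul, typ_comp, kappaWord_comp]

/-- The map `κ : V^{⊗ n} ⊗_{ℂ S_n} C̃ → ⨁_ν C̃_ν` (see `kappa_mk`). -/
def kappa (n : ℕ) : TensCoinv n →ₗ[ℂ] ⨁ ν : Comp n, antiInv ν :=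
  letI : AddCommGroup (⨁ ν : Comp n, antiInv ν) := Module.addCommMonoidToAddCommGroup ℂ
  (balanced n).liftQ (kappaAux n) (balanced_le_ker n)

theorem kappa_apply {n : ℕ} (z : Tens n ⊗[ℂ] Coinv n) :
    kappa n (Submodule.Quotient.mk z) = kappaAux n z := rfl

open Classical in
/-- `κ (v_{a_1} ⊗ ⋯ ⊗ v_{a_n} ⊗ m) = (1 / |S_ν|) ∑_{w ∈ S_ν} w m ∈ C̃_ν` if `a` is the
increasing word of type `ν`. -/
theorem kappa_mk {n : ℕ} (ν : Comp n) (m : Coinv n) :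
    ∃ x : antiInv ν,
      (x : Coinv n) = (1 / (Nat.card (young ν) : ℂ)) •
        ∑ w : Equiv.Perm (Fin n) with w ∈ young ν, twist w m ∧
      kappa n (Submodule.Quotient.mk
        ((PiTensorProduct.tprod ℂ fun j => Finsupp.single (word ν j) (1 : ℂ)) ⊗ₜ[ℂ] m)) =
        DirectSum.lof ℂ (Comp n) (fun ν => antiInv ν) ν x := by
  refine ⟨kappaWord ν (word ν) m, ?_, ?_⟩
  · rw [coe_kappaWord]
    refine congrArg _ (Finset.sum_congr (Finset.filter_congr fun w _ => Iff.rfl) fun _ _ => rfl)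
  · rw [← tensBasis_apply]
    rw [kappa_apply, kappaAux_tmul, typ_word]

/-- The map `φ : V^{⊗ n} ⊗_{ℂ S_n} C̃ → ⨁_ν C_ν`, the composite of `κ` with the direct sum of
the push-forwards `π_* : C̃_ν → C_ν`. -/
def phi (n : ℕ) : TensCoinv n →ₗ[ℂ] ⨁ ν : Comp n, inv (young ν) :=
  DirectSum.lmap (fun ν => piPush ν) ∘ₗ kappa n

/-- The action of `gl_∞` on `⨁_ν C_ν` obtained by transport through the bijection `φ`. -/
def coinvRep (n : ℕ) (h : Function.Bijective (phi n)) :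
    glInf →ₗ⁅ℂ⁆ Module.End ℂ (⨁ ν : Comp n, inv (young ν)) :=
  (LinearEquiv.ofBijective (phi n) h).lieConj.toLieHom.comp (tensCoinvRep n)

theorem coinvRep_phi (n : ℕ) (h : Function.Bijective (phi n)) (X : glInf) (t : TensCoinv n) :
    coinvRep n h X (phi n t) = phi n (tensCoinvRep n X t) := by
  change (LinearEquiv.ofBijective (phi n) h) (tensCoinvRep n X
    ((LinearEquiv.ofBijective (phi n) h).symm (LinearEquiv.ofBijective (phi n) h t))) = _
  rw [LinearEquiv.symm_apply_apply]
  rfl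

/-- The summand embedding `C_ν → ⨁_ν C_ν`. -/
def toSum {n : ℕ} (ν : Comp n) : inv (young ν) →ₗ[ℂ] ⨁ ν : Comp n, inv (young ν) :=
  DirectSum.lof ℂ (Comp n) (fun ν => inv (young ν)) ν

/-! ### Symmetric polynomials in a block -/

/-- `e_r(ν; i)` in `C`, for `r ∈ ℕ`. -/
def elem {n : ℕ} (ν : Comp n) (i : ℤ) (r : ℕ) : Coinv n :=
  toCoinv n (MvPolynomial.rename Subtype.val
    (MvPolynomial.esymm {j : Fin n // j ∈ block ν i} ℂ r))

/-- `h_r(ν; i)` in `C`, for `r ∈ ℤ`; it is zero for `r < 0`. -/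
def compl {n : ℕ} (ν : Comp n) (i : ℤ) (r : ℤ) : Coinv n :=
  if 0 ≤ r then toCoinv n (MvPolynomial.rename Subtype.val
    (MvPolynomial.hsymm {j : Fin n // j ∈ block ν i} ℂ r.toNat)) else 0

/-- `ν'` is obtained from `ν` by replacing `ν_i` by `ν_i - 1` and `ν_{i+1}` by `ν_{i+1} + 1`. -/
def KeySituation {n : ℕ} (i : ℤ) (ν ν' : Comp n) : Prop :=
  ν.1 i = ν'.1 i + 1 ∧ ν'.1 (i + 1) = ν.1 (i + 1) + 1 ∧
    ∀ j, j ≠ i → j ≠ i + 1 → ν'.1 j = ν.1 j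

/-- `g : C^K → C^H` is the unique `C^H`-module homomorphism with `g (x ^ r) = c r` in `C` for all
`r ≥ 0`. (A `C^H`-module homomorphism is automatically `ℂ`-linear.) -/
def IsUniqueModuleHom {n : ℕ} {K H : Subgroup (Equiv.Perm (Fin n))} (h : K ≤ H) (x : inv K)
    (c : ℕ → Coinv n) (g : inv K →ₗ[ℂ] inv H) : Prop :=
  ∀ g' : inv K →ₗ[ℂ] inv H,
    ((∀ (z : inv H) (y : inv K), g' (pullback h z * y) = z * g' y) ∧
      ∀ r : ℕ, (g' (x ^ r) : Coinv n) = c r) ↔ g' = g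

end

end CoinvGl

namespace CoinvGl

noncomputable section

open MvPolynomial

variable {n : ℕ}

/-! ### Divisibility by products of differences of variables -/

/-! For a parabolic subgroup `H` let ε_H be the product of the x_i - x_j over the pairs i < j in one
orbit, and let D_H be antisymmetrisation over `H` followed by division by ε_H (`dem`, and `ddem` on
C). D_H is linear over the `H`-invariants, so it preserves the ideal I and descends to C. Everything
in the theorem is rewritten in terms of D_H and ε_H.

Duality: the integral on C is the constant term of D for the full symmetric group. It is
non-degenerate because the socle of C is the line spanned by the Vandermonde product: a
divided-difference computation shows that socle elements change sign under transpositions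
(`perm_swap_of_socle`). The integral on C^H is x ↦ ∫ x ε_H / |H|, and its non-degeneracy follows by
testing against elements D_H(y ε_H). The adjunction `int0_mul_ddem` then identifies the push-forward
C^K → C^H with z ↦ D_H(z ε_K) / |K| (`coe_pushforward`).

The action: `kappa` is inverted by m ↦ v_a ⊗ m, with a the increasing word, and the push-forward on
S_ν-anti-invariants is inverted by f ↦ f ε_ν / |S_ν|; so φ is bijective and f corresponds to v_a ⊗ f
ε_ν / |S_ν|. A matrix unit changes one letter q of a at a time. By anti-invariance the ν_q resulting
terms coincide, and choosing the position at the edge of the block keeps the word increasing. Hence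
f goes to (ν_q / |S_ν|) D_ν'(f ε_ν) (`coinvRep_matrixUnit`). With K = S_ν ∩ S_ν', the stabiliser of
k in S_ν, one has ε_ν = ε_K δ and |S_ν| = ν_q |K|, so this is the push-forward of δ f
(`coinvRep_eq_pushforward`), with δ the stated product of differences.

Formulas: with Y the orbit of k and b + 1 its size, the push-forward of x_k^t is, up to sign,
h_(t-b)(Y): both sides vanish for t < b, agree at t = b, and obey the recursion with coefficients ±
e_s(Y) (`PointStab.ppush_X_pow`). Expanding δ in powers of x_k yields the displayed values. They
determine the homomorphism because powers of x_k generate C^K over C^H (`PointStab.exists_eq_sum`).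
-/

theorem X_sub_X_dvd_iff {i j : Fin n} (f : MvPolynomial (Fin n) ℂ) :
    (X i - X j) ∣ f ↔ aeval (Function.update X i (X j : MvPolynomial (Fin n) ℂ)) f = 0 := by
  -- Every polynomial is congruent to its substitution x_i := x_j modulo x_i - x_j. For i = j the
  -- substitution is the identity, and the equivalence still holds.
  have hself : ∀ f : MvPolynomial (Fin n) ℂ,
      (X i - X j) ∣ f - aeval (Function.update X i (X j : MvPolynomial (Fin n) ℂ)) f := by
    intro f
    induction f using MvPolynomial.induction_on with
    | C a => simp
    | add p q hp hq =>
      rw [map_add, add_sub_add_comm]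
      exact dvd_add hp hq
    | mul_X p l hp =>
      rw [map_mul, aeval_X]
      have : p * X l - aeval (Function.update X i (X j : MvPolynomial (Fin n) ℂ)) p *
          Function.update X i (X j) l =
          (p - aeval (Function.update X i (X j : MvPolynomial (Fin n) ℂ)) p) *
            Function.update X i (X j) l + p * (X l - Function.update X i (X j) l) := by ring
      rw [this]
      refine dvd_add (hp.mul_right _) (Dvd.dvd.mul_left ?_ _)
      by_cases h : l = i
      · subst h; simp
      · simp [h]
  constructor
  · rintro ⟨g, rfl⟩
    rw [map_mul, map_sub, aeval_X, aeval_X, Function.update_self]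
    by_cases h : j = i
    · subst h; simp
    · simp [h]
  · intro h
    have h2 := hself f
    rwa [h, sub_zero] at h2

theorem X_sub_X_ne_zero {i j : Fin n} (h : i ≠ j) :
    (X i - X j : MvPolynomial (Fin n) ℂ) ≠ 0 :=
  sub_ne_zero.2 fun h' => h (X_injective h')

/-- The difference generates the kernel of a substitution homomorphism with values in a domain. -/
theorem prime_X_sub_X {i j : Fin n} (h : i ≠ j) :
    Prime (X i - X j : MvPolynomial (Fin n) ℂ) := by
  refine ⟨X_sub_X_ne_zero h, fun hu => ?_, fun a b hab => ?_⟩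
  · have := (X_sub_X_dvd_iff (i := i) (j := j) 1).1 hu.dvd
    simp at this
  · rw [X_sub_X_dvd_iff] at hab ⊢
    rw [X_sub_X_dvd_iff (f := b)]
    rwa [map_mul, mul_eq_zero] at hab

/-- The factors are pairwise non-associate primes; the condition p.1 < p.2 excludes a difference
occurring together with its negative. -/
theorem prod_X_sub_X_dvd (T : Finset (Fin n × Fin n)) (hT : ∀ p ∈ T, p.1 < p.2)
    (f : MvPolynomial (Fin n) ℂ) (hf : ∀ p ∈ T, (X p.1 - X p.2) ∣ f) :
    (∏ p ∈ T, (X p.1 - X p.2)) ∣ f := by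
  classical
  induction T using Finset.induction_on with
  | empty => simp
  | insert p T hp ih =>
    obtain ⟨q, hq⟩ := ih (fun p hp => hT p (Finset.mem_insert_of_mem hp))
      (fun p hp => hf p (Finset.mem_insert_of_mem hp))
    have hlt := hT p (Finset.mem_insert_self _ _)
    have hpr := prime_X_sub_X hlt.ne
    have h1 := hf p (Finset.mem_insert_self _ _)
    rw [Finset.prod_insert hp, hq, mul_comm]
    refine mul_dvd_mul_left _ ?_
    rw [hq] at h1
    refine (hpr.dvd_or_dvd h1).resolve_left fun h2 => ?_
    obtain ⟨r, hr, h3⟩ := (Prime.dvd_finsetProd_iff hpr _).1 h2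
    have hlt' := hT r (Finset.mem_insert_of_mem hr)
    -- Identifying the two variables of p can kill the difference of r only if r involves the same
    -- two variables.
    rw [X_sub_X_dvd_iff, map_sub, aeval_X, aeval_X, sub_eq_zero] at h3
    have hne : r ≠ p := fun h => hp (h ▸ hr)
    rw [Function.update_apply, Function.update_apply] at h3
    split_ifs at h3 with h4 h5 h5
    · exact hlt'.ne (h4.trans h5.symm)
    · exact hne (Prod.ext h4 (X_injective h3).symm)
    · have := X_injective h3
      rw [h5, this] at hlt'
      exact absurd hlt' hlt.asymm
    · exact hlt'.ne (X_injective h3)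

theorem X_sub_X_dvd_sub_rename_swap (i j : Fin n) (f : MvPolynomial (Fin n) ℂ) :
    (X i - X j) ∣ f - rename (Equiv.swap i j) f := by
  rw [X_sub_X_dvd_iff, map_sub, aeval_rename, sub_eq_zero]
  congr 2
  funext l
  by_cases h : l = i
  · subst h
    by_cases h2 : j = l
    · subst h2; simp
    · simp [h2]
  · by_cases h2 : l = j
    · subst h2; simp [h]
    · simp [Equiv.swap_apply_of_ne_of_ne h h2, h]

/-! ### Parabolic subgroups and their Vandermonde products -/

/-- The subgroups of the symmetric group that are parabolic with respect to the usual order: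
products of full symmetric groups on consecutive intervals. -/
structure Parab (H : Subgroup (Equiv.Perm (Fin n))) : Prop where
  swap_mem : ∀ i j, i ∈ MulAction.orbit H j → Equiv.swap i j ∈ H
  lt_of_lt : ∀ w ∈ H, ∀ i j, i < j → i ∉ MulAction.orbit H j → w i < w j

open Classical in
/-- The pairs `i < j` that lie in one `H`-orbit. -/
def samePairs (H : Subgroup (Equiv.Perm (Fin n))) : Finset (Fin n × Fin n) :=
  Finset.univ.filter fun p => p.1 < p.2 ∧ p.1 ∈ MulAction.orbit H p.2

/-- The product of the differences `x_i - x_j` over the pairs `i < j` in one `H`-orbit. -/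
def epsPoly (H : Subgroup (Equiv.Perm (Fin n))) : MvPolynomial (Fin n) ℂ :=
  ∏ p ∈ samePairs H, (X p.1 - X p.2)

/-- The product of the differences `x_i - x_j` over the pairs `i < j` in different
`H`-orbits. -/
def crossPoly (H : Subgroup (Equiv.Perm (Fin n))) : MvPolynomial (Fin n) ℂ :=
  ∏ p ∈ crossPairs H, (X p.1 - X p.2)

theorem mem_samePairs {H : Subgroup (Equiv.Perm (Fin n))} {p : Fin n × Fin n} :
    p ∈ samePairs H ↔ p.1 < p.2 ∧ p.1 ∈ MulAction.orbit H p.2 := by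
  simp [samePairs]

theorem mem_crossPairs {H : Subgroup (Equiv.Perm (Fin n))} {p : Fin n × Fin n} :
    p ∈ crossPairs H ↔ p.1 < p.2 ∧ p.1 ∉ MulAction.orbit H p.2 := by
  simp [crossPairs]

theorem mem_orbit_iff {H : Subgroup (Equiv.Perm (Fin n))} {i j : Fin n} :
    i ∈ MulAction.orbit H j ↔ ∃ w ∈ H, w j = i := by
  constructor
  · rintro ⟨w, rfl⟩
    exact ⟨w, w.2, rfl⟩
  · rintro ⟨w, hw, rfl⟩
    exact ⟨⟨w, hw⟩, rfl⟩

theorem mem_orbit_top (i j : Fin n) :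
    i ∈ MulAction.orbit (⊤ : Subgroup (Equiv.Perm (Fin n))) j :=
  mem_orbit_iff.2 ⟨Equiv.swap j i, trivial, Equiv.swap_apply_left _ _⟩

theorem parab_top : Parab (⊤ : Subgroup (Equiv.Perm (Fin n))) :=
  ⟨fun _ _ _ => trivial, fun _ _ i j _ h => absurd (mem_orbit_top i j) h⟩

theorem apply_mem_orbit_iff {H : Subgroup (Equiv.Perm (Fin n))} {w : Equiv.Perm (Fin n)}
    (hw : w ∈ H) (i j : Fin n) :
    w i ∈ MulAction.orbit H (w j) ↔ i ∈ MulAction.orbit H j := by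
  rw [mem_orbit_iff, mem_orbit_iff]
  constructor
  · rintro ⟨u, hu, h⟩
    refine ⟨w⁻¹ * u * w, H.mul_mem (H.mul_mem (H.inv_mem hw) hu) hw, ?_⟩
    rw [Equiv.Perm.mul_apply, Equiv.Perm.mul_apply, h]
    exact w.symm_apply_apply i
  · rintro ⟨u, hu, rfl⟩
    refine ⟨w * u * w⁻¹, H.mul_mem (H.mul_mem hw hu) (H.inv_mem hw), ?_⟩
    rw [Equiv.Perm.mul_apply, Equiv.Perm.mul_apply]
    exact congrArg (fun z => w (u z)) (w.symm_apply_apply j)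

theorem epsPoly_ne_zero (H : Subgroup (Equiv.Perm (Fin n))) : epsPoly H ≠ 0 :=
  Finset.prod_ne_zero_iff.2 fun _ hp => X_sub_X_ne_zero (mem_samePairs.1 hp).1.ne

theorem crossPoly_ne_zero (H : Subgroup (Equiv.Perm (Fin n))) : crossPoly H ≠ 0 :=
  Finset.prod_ne_zero_iff.2 fun _ hp => X_sub_X_ne_zero (mem_crossPairs.1 hp).1.ne

theorem epsPoly_isHomogeneous (H : Subgroup (Equiv.Perm (Fin n))) :
    (epsPoly H).IsHomogeneous (samePairs H).card := by
  rw [Finset.card_eq_sum_ones]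
  exact IsHomogeneous.prod _ _ _ fun p _ => (isHomogeneous_X _ _).sub (isHomogeneous_X _ _)

theorem card_samePairs_top (H : Subgroup (Equiv.Perm (Fin n))) :
    (samePairs (⊤ : Subgroup (Equiv.Perm (Fin n)))).card =
      (crossPairs H).card + (samePairs H).card := by
  classical
  rw [← Finset.card_union_of_disjoint]
  · congr 1
    ext p
    simp only [Finset.mem_union, mem_samePairs, mem_crossPairs, mem_orbit_top]
    tauto
  · rw [Finset.disjoint_left]
    intro p hp hp'
    exact (mem_crossPairs.1 hp).2 (mem_samePairs.1 hp').2

theorem epsPoly_top (H : Subgroup (Equiv.Perm (Fin n))) :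
    epsPoly (⊤ : Subgroup (Equiv.Perm (Fin n))) = crossPoly H * epsPoly H := by
  classical
  rw [epsPoly, crossPoly, epsPoly, ← Finset.prod_union]
  · refine Finset.prod_congr ?_ fun _ _ => rfl
    ext p
    simp only [Finset.mem_union, mem_samePairs, mem_crossPairs, mem_orbit_top]
    tauto
  · rw [Finset.disjoint_left]
    intro p hp hp'
    exact (mem_crossPairs.1 hp).2 (mem_samePairs.1 hp').2

/-- The sign of a permutation as a complex number. -/
def sgn (w : Equiv.Perm (Fin n)) : ℂ := ((Equiv.Perm.sign w : ℤ) : ℂ)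

@[simp] theorem sgn_mul (u w : Equiv.Perm (Fin n)) : sgn (u * w) = sgn u * sgn w := by
  simp [sgn]

@[simp] theorem sgn_one : sgn (1 : Equiv.Perm (Fin n)) = 1 := by simp [sgn]

@[simp] theorem sgn_mul_self (w : Equiv.Perm (Fin n)) : sgn w * sgn w = 1 := by
  rw [sgn, ← Int.cast_mul, ← Units.val_mul, Int.units_mul_self]
  simp

theorem sgn_swap {i j : Fin n} (h : i ≠ j) : sgn (Equiv.swap i j) = -1 := by
  simp [sgn, Equiv.Perm.sign_swap h]

theorem rename_epsPoly_top (w : Equiv.Perm (Fin n)) :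
    rename w (epsPoly (⊤ : Subgroup (Equiv.Perm (Fin n)))) = sgn w • epsPoly ⊤ := by
  have h : ∀ u : Equiv.Perm (Fin n), rename u (epsPoly (⊤ : Subgroup (Equiv.Perm (Fin n)))) =
      ∏ i, ∏ j ∈ Finset.Ioi i, (X (u i) - X (u j)) := by
    intro u
    rw [epsPoly, map_prod, Finset.prod_sigma']
    refine Finset.prod_bij' (fun p _ => ⟨p.1, p.2⟩) (fun p _ => (p.1, p.2)) ?_ ?_ ?_ ?_ ?_
    · intro p hp
      simpa using (mem_samePairs.1 hp).1
    · intro p hp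
      exact mem_samePairs.2 ⟨by simpa using hp, mem_orbit_top _ _⟩
    · intro p _; rfl
    · intro p _; rfl
    · intro p _; simp
  rw [h, Equiv.Perm.prod_Ioi_comp_eq_sign_mul_prod w
    (f := fun i j => (X i - X j : MvPolynomial (Fin n) ℂ)) (by intro i j; ring)]
  have h1 := h 1
  rw [show ((1 : Equiv.Perm (Fin n)) : Fin n → Fin n) = id from rfl, rename_id_apply] at h1
  rw [h1, sgn, smul_eq_C_mul]
  simp

/-- An element of a parabolic subgroup preserves the order of any two points in different orbits, so
it permutes the factors without changing a sign. -/
theorem Parab.rename_crossPoly {H : Subgroup (Equiv.Perm (Fin n))} (hH : Parab H)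
    {w : Equiv.Perm (Fin n)} (hw : w ∈ H) : rename w (crossPoly H) = crossPoly H := by
  rw [crossPoly, map_prod]
  have key : ∀ u ∈ H, ∀ p ∈ crossPairs H, (u p.1, u p.2) ∈ crossPairs H := by
    intro u hu p hp
    rw [mem_crossPairs] at hp ⊢
    exact ⟨hH.lt_of_lt u hu _ _ hp.1 hp.2, fun h => hp.2 ((apply_mem_orbit_iff hu _ _).1 h)⟩
  refine Finset.prod_bij' (fun p _ => (w p.1, w p.2)) (fun p _ => (w⁻¹ p.1, w⁻¹ p.2))
    (key w hw) (key w⁻¹ (H.inv_mem hw)) ?_ ?_ ?_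
  · intro p _; simp
  · intro p _; simp
  · intro p _; simp

/-- The full Vandermonde product is alternating and its factor `crossPoly H` is `H`-invariant, so
the cofactor carries the sign. -/
theorem Parab.rename_epsPoly {H : Subgroup (Equiv.Perm (Fin n))} (hH : Parab H)
    {w : Equiv.Perm (Fin n)} (hw : w ∈ H) : rename w (epsPoly H) = sgn w • epsPoly H := by
  have h := rename_epsPoly_top w
  rw [epsPoly_top H, map_mul, hH.rename_crossPoly hw, ← mul_smul_comm] at h
  exact mul_left_cancel₀ (crossPoly_ne_zero H) h

/-! ### Antisymmetrisation and Demazure operators -/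

open Classical in
/-- Antisymmetrisation over a subgroup. -/
def antisym (H : Subgroup (Equiv.Perm (Fin n))) :
    MvPolynomial (Fin n) ℂ →ₗ[ℂ] MvPolynomial (Fin n) ℂ :=
  ∑ w : Equiv.Perm (Fin n) with w ∈ H, sgn w • (rename w).toLinearMap

open Classical in
theorem antisym_apply (H : Subgroup (Equiv.Perm (Fin n))) (f : MvPolynomial (Fin n) ℂ) :
    antisym H f = ∑ w : Equiv.Perm (Fin n) with w ∈ H, sgn w • rename w f := by
  simp [antisym]

theorem rename_mul (u w : Equiv.Perm (Fin n)) (f : MvPolynomial (Fin n) ℂ) :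
    rename (u * w) f = rename u (rename w f) := by
  rw [rename_rename]; rfl

open Classical in
theorem sum_mul_left_mem {M : Type*} [AddCommMonoid M] {H : Subgroup (Equiv.Perm (Fin n))}
    {u : Equiv.Perm (Fin n)} (hu : u ∈ H) (g : Equiv.Perm (Fin n) → M) :
    ∑ w : Equiv.Perm (Fin n) with w ∈ H, g (u * w) =
      ∑ w : Equiv.Perm (Fin n) with w ∈ H, g w := by
  refine Finset.sum_bij' (fun w _ => u * w) (fun w _ => u⁻¹ * w) ?_ ?_ ?_ ?_ ?_
  · intro w hw
    simpa using H.mul_mem hu (by simpa using hw)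
  · intro w hw
    simpa using H.mul_mem (H.inv_mem hu) (by simpa using hw)
  · intro w _; simp
  · intro w _; simp
  · intro w _; rfl

open Classical in
theorem sum_mul_right_mem {M : Type*} [AddCommMonoid M] {H : Subgroup (Equiv.Perm (Fin n))}
    {u : Equiv.Perm (Fin n)} (hu : u ∈ H) (g : Equiv.Perm (Fin n) → M) :
    ∑ w : Equiv.Perm (Fin n) with w ∈ H, g (w * u) =
      ∑ w : Equiv.Perm (Fin n) with w ∈ H, g w := by
  refine Finset.sum_bij' (fun w _ => w * u) (fun w _ => w * u⁻¹) ?_ ?_ ?_ ?_ ?_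
  · intro w hw
    simpa using H.mul_mem (by simpa using hw) hu
  · intro w hw
    simpa using H.mul_mem (by simpa using hw) (H.inv_mem hu)
  · intro w _; simp
  · intro w _; simp
  · intro w _; rfl

theorem rename_antisym {H : Subgroup (Equiv.Perm (Fin n))} {u : Equiv.Perm (Fin n)}
    (hu : u ∈ H) (f : MvPolynomial (Fin n) ℂ) :
    rename u (antisym H f) = sgn u • antisym H f := by
  classical
  rw [antisym_apply, map_sum, ← sum_mul_left_mem hu fun w => sgn w • rename w f, Finset.smul_sum]
  refine Finset.sum_congr rfl fun w _ => ?_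
  rw [map_smul, sgn_mul, smul_smul, ← mul_assoc, sgn_mul_self, one_mul, rename_mul]

theorem antisym_rename {H : Subgroup (Equiv.Perm (Fin n))} {u : Equiv.Perm (Fin n)}
    (hu : u ∈ H) (f : MvPolynomial (Fin n) ℂ) :
    antisym H (rename u f) = sgn u • antisym H f := by
  classical
  rw [antisym_apply, antisym_apply, ← sum_mul_right_mem hu fun w => sgn w • rename w f,
    Finset.smul_sum]
  refine Finset.sum_congr rfl fun w _ => ?_
  rw [sgn_mul, smul_smul, mul_comm (sgn w), ← mul_assoc, sgn_mul_self, one_mul, rename_mul]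

theorem antisym_mul {H : Subgroup (Equiv.Perm (Fin n))} {s : MvPolynomial (Fin n) ℂ}
    (hs : ∀ w ∈ H, rename w s = s) (f : MvPolynomial (Fin n) ℂ) :
    antisym H (s * f) = s * antisym H f := by
  classical
  rw [antisym_apply, antisym_apply, Finset.mul_sum]
  refine Finset.sum_congr rfl fun w hw => ?_
  rw [map_mul, hs w (by simpa using hw), mul_smul_comm]

open Classical in
theorem card_filter_mem (H : Subgroup (Equiv.Perm (Fin n))) :
    (Finset.univ.filter fun w : Equiv.Perm (Fin n) => w ∈ H).card = Nat.card H := by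
  rw [Nat.card_eq_fintype_card, Fintype.card_subtype]

theorem antisym_of_anti {H : Subgroup (Equiv.Perm (Fin n))} {f : MvPolynomial (Fin n) ℂ}
    (hf : ∀ w ∈ H, rename w f = sgn w • f) : antisym H f = (Nat.card H : ℂ) • f := by
  classical
  rw [antisym_apply, Finset.sum_congr rfl (g := fun _ => f), Finset.sum_const, card_filter_mem,
    Nat.cast_smul_eq_nsmul]
  intro w hw
  rw [hf w (by simpa using hw), smul_smul, sgn_mul_self, one_smul]

/-- An alternating f satisfies f - (i j) f = 2f, and the left side is divisible by x_i - x_j. -/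
theorem Parab.epsPoly_dvd_antisym {H : Subgroup (Equiv.Perm (Fin n))} (hH : Parab H)
    (f : MvPolynomial (Fin n) ℂ) : epsPoly H ∣ antisym H f := by
  refine prod_X_sub_X_dvd _ (fun p hp => (mem_samePairs.1 hp).1) _ fun p hp => ?_
  obtain ⟨hlt, ho⟩ := mem_samePairs.1 hp
  have h := X_sub_X_dvd_sub_rename_swap p.1 p.2 (antisym H f)
  rw [rename_antisym (hH.swap_mem _ _ ho), sgn_swap hlt.ne, neg_one_smul, sub_neg_eq_add,
    ← two_mul, show (2 : MvPolynomial (Fin n) ℂ) = C 2 from (map_ofNat C 2).symm] at h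
  refine (IsUnit.dvd_mul_left ?_).1 h
  exact (isUnit_iff_ne_zero.2 two_ne_zero).map C

open Classical in
/-- The Demazure operator of the longest element of `H`: antisymmetrisation divided by
`epsPoly H`. -/
def dem (H : Subgroup (Equiv.Perm (Fin n))) :
    MvPolynomial (Fin n) ℂ →ₗ[ℂ] MvPolynomial (Fin n) ℂ :=
  if h : Parab H then
    { toFun := fun f => (h.epsPoly_dvd_antisym f).choose
      map_add' := fun f g => by
        refine mul_left_cancel₀ (epsPoly_ne_zero H) ?_
        rw [mul_add, ← (h.epsPoly_dvd_antisym _).choose_spec,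
          ← (h.epsPoly_dvd_antisym _).choose_spec, ← (h.epsPoly_dvd_antisym _).choose_spec,
          map_add]
      map_smul' := fun c f => by
        refine mul_left_cancel₀ (epsPoly_ne_zero H) ?_
        rw [RingHom.id_apply, mul_smul_comm, ← (h.epsPoly_dvd_antisym _).choose_spec,
          ← (h.epsPoly_dvd_antisym _).choose_spec, map_smul] }
  else 0

namespace Parab

variable {H : Subgroup (Equiv.Perm (Fin n))} (hH : Parab H)
include hH

theorem epsPoly_mul_dem (f : MvPolynomial (Fin n) ℂ) :
    epsPoly H * dem H f = antisym H f := by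
  rw [dem, dif_pos hH]
  exact (hH.epsPoly_dvd_antisym f).choose_spec.symm

theorem dem_eq_of_mul_eq {f g : MvPolynomial (Fin n) ℂ} (h : epsPoly H * g = antisym H f) :
    dem H f = g :=
  mul_left_cancel₀ (epsPoly_ne_zero H) ((hH.epsPoly_mul_dem f).trans h.symm)

theorem dem_mul {s : MvPolynomial (Fin n) ℂ} (hs : ∀ w ∈ H, rename w s = s)
    (f : MvPolynomial (Fin n) ℂ) : dem H (s * f) = s * dem H f := by
  refine hH.dem_eq_of_mul_eq ?_
  rw [antisym_mul hs, ← hH.epsPoly_mul_dem]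
  ring

theorem dem_rename {w : Equiv.Perm (Fin n)} (hw : w ∈ H) (f : MvPolynomial (Fin n) ℂ) :
    dem H (rename w f) = sgn w • dem H f := by
  refine hH.dem_eq_of_mul_eq ?_
  rw [antisym_rename hw, ← hH.epsPoly_mul_dem, mul_smul_comm]

theorem rename_dem {w : Equiv.Perm (Fin n)} (hw : w ∈ H) (f : MvPolynomial (Fin n) ℂ) :
    rename w (dem H f) = dem H f := by
  have h := rename_antisym hw f
  rw [← hH.epsPoly_mul_dem, map_mul, hH.rename_epsPoly hw, smul_mul_assoc] at h
  have h2 := congrArg (fun z => sgn w • z) h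
  simp only [smul_smul, sgn_mul_self, one_smul] at h2
  exact mul_left_cancel₀ (epsPoly_ne_zero H) h2

theorem dem_epsPoly : dem H (epsPoly H) = C (Nat.card H : ℂ) := by
  refine hH.dem_eq_of_mul_eq ?_
  rw [antisym_of_anti fun w hw => hH.rename_epsPoly hw, smul_eq_C_mul, mul_comm]

end Parab

/-! ### Degrees -/

section
attribute [local instance] MvPolynomial.gradedAlgebra

/-- Since `dem` is known only through its product with `epsPoly H`, its degree has to be read off
after multiplication by a homogeneous polynomial. -/
theorem homogeneousComponent_mul_of_isHomogeneous {N : ℕ} {e : MvPolynomial (Fin n) ℂ}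
    (he : e.IsHomogeneous N) (g : MvPolynomial (Fin n) ℂ) (d : ℕ) :
    homogeneousComponent (N + d) (e * g) = e * homogeneousComponent d g := by
  have h := DirectSum.coe_decompose_mul_add_of_left_mem (homogeneousSubmodule (Fin n) ℂ)
    (i := N) (j := d) (a := e) (b := g) he
  have h2 : ∀ (p : MvPolynomial (Fin n) ℂ) (i : ℕ),
    (DirectSum.decompose (homogeneousSubmodule (Fin n) ℂ) p i : MvPolynomial (Fin n) ℂ) =
      homogeneousComponent i p := decomposition.decompose'_apply
  rwa [h2, h2] at h

end

theorem antisym_isHomogeneous (H : Subgroup (Equiv.Perm (Fin n))) {f : MvPolynomial (Fin n) ℂ}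
    {d : ℕ} (hf : f.IsHomogeneous d) : (antisym H f).IsHomogeneous d := by
  classical
  rw [antisym_apply]
  refine IsHomogeneous.sum _ _ _ fun w _ => ?_
  rw [smul_eq_C_mul]
  exact hf.rename_isHomogeneous.C_mul _

namespace Parab

variable {H : Subgroup (Equiv.Perm (Fin n))} (hH : Parab H)
include hH

theorem homogeneousComponent_dem_of_ne {f : MvPolynomial (Fin n) ℂ} {d e : ℕ}
    (hf : f.IsHomogeneous d) (h : (samePairs H).card + e ≠ d) :
    homogeneousComponent e (dem H f) = 0 := by
  have h1 := homogeneousComponent_mul_of_isHomogeneous (epsPoly_isHomogeneous H) (dem H f) e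
  rw [hH.epsPoly_mul_dem, homogeneousComponent_of_mem (antisym_isHomogeneous H hf), if_neg h]
    at h1
  exact (mul_eq_zero.1 h1.symm).resolve_left (epsPoly_ne_zero H)

theorem dem_eq_zero_of_lt {f : MvPolynomial (Fin n) ℂ} {d : ℕ}
    (hf : f.IsHomogeneous d) (h : d < (samePairs H).card) : dem H f = 0 := by
  rw [← sum_homogeneousComponent (dem H f)]
  exact Finset.sum_eq_zero fun e _ => hH.homogeneousComponent_dem_of_ne hf (by omega)

end Parab

/-! ### Elementary symmetric polynomials of a set of variables -/

/-- The elementary symmetric polynomial of degree `r` in the variables `x_l`, `l ∈ Y`. -/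
def esym (Y : Finset (Fin n)) (r : ℕ) : MvPolynomial (Fin n) ℂ := (Y.val.map X).esymm r

theorem esym_zero (Y : Finset (Fin n)) : esym Y 0 = 1 := by
  simp [esym, Multiset.esymm, Multiset.powersetCard_zero_left]

theorem esym_eq_sum (Y : Finset (Fin n)) (r : ℕ) :
    esym Y r = ∑ t ∈ Y.powersetCard r, ∏ l ∈ t, X l := by
  rw [esym, Finset.esymm_map_val]

theorem prod_sub_X_eq_sum_esym (Y : Finset (Fin n)) (t : MvPolynomial (Fin n) ℂ) :
    ∏ l ∈ Y, (t - X l) =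
      ∑ j ∈ Finset.range (Y.card + 1), (-1) ^ j * (esym Y j * t ^ (Y.card - j)) := by
  have h := congrArg (Polynomial.eval t) (Multiset.prod_X_sub_X_eq_sum_esymm
    (Y.val.map (X : Fin n → MvPolynomial (Fin n) ℂ)))
  rw [Multiset.map_map, Polynomial.eval_multiset_prod, Multiset.map_map, Multiset.card_map,
    Polynomial.eval_finsetSum] at h
  simpa [Finset.prod_map_val, esym] using h

theorem rename_esym {Y : Finset (Fin n)} {w : Equiv.Perm (Fin n)} (hw : ∀ l, w l ∈ Y ↔ l ∈ Y)
    (r : ℕ) : rename w (esym Y r) = esym Y r := by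
  have hY : Y.map w.toEmbedding = Y := by
    ext l
    simp only [Finset.mem_map, Equiv.coe_toEmbedding]
    constructor
    · rintro ⟨m, hm, rfl⟩
      exact (hw m).2 hm
    · intro hl
      exact ⟨w.symm l, (hw _).1 (by simpa using hl), by simp⟩
  conv_rhs => rw [← hY]
  rw [esym_eq_sum, esym_eq_sum, map_sum, Finset.powersetCard_map, Finset.sum_map]
  refine Finset.sum_congr rfl fun t _ => ?_
  simp [Finset.mapEmbedding]

theorem esym_isHomogeneous (Y : Finset (Fin n)) (r : ℕ) : (esym Y r).IsHomogeneous r := by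
  rw [esym_eq_sum]
  refine IsHomogeneous.sum _ _ _ fun t ht => ?_
  have h := IsHomogeneous.prod t (fun l => (X l : MvPolynomial (Fin n) ℂ)) (fun _ => 1)
    fun l _ => isHomogeneous_X _ _
  rwa [← Finset.card_eq_sum_ones, (Finset.mem_powersetCard.1 ht).2] at h

/-! ### The coinvariant algebra -/

theorem toCoinv_surjective : Function.Surjective (toCoinv n) :=
  Ideal.Quotient.mkₐ_surjective ℂ (symIdeal n)

theorem algebraMap_mul (c : ℂ) (x : Coinv n) : algebraMap ℂ (Coinv n) c * x = c • x :=
  (Algebra.smul_def c x).symm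

theorem toCoinv_eq_zero_iff {f : MvPolynomial (Fin n) ℂ} : toCoinv n f = 0 ↔ f ∈ symIdeal n :=
  Ideal.Quotient.eq_zero_iff_mem

theorem mem_symIdeal_of_symmetric {f : MvPolynomial (Fin n) ℂ} (hf : f.IsSymmetric) {d : ℕ}
    (hd : 0 < d) (h : f.IsHomogeneous d) : f ∈ symIdeal n :=
  Ideal.subset_span ⟨hf, d, hd, h⟩

/-- Each x_i is a root of ∏ (T - x_l), which becomes T^n in C because the e_s with s > 0 lie in the
ideal. -/
theorem toCoinv_X_pow (i : Fin n) : toCoinv n (X i) ^ n = 0 := by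
  have h := prod_sub_X_eq_sum_esym Finset.univ (X i : MvPolynomial (Fin n) ℂ)
  rw [Finset.prod_eq_zero (Finset.mem_univ i) (sub_self _), Finset.sum_range_succ',
    esym_zero] at h
  have h2 := congrArg (toCoinv n) h
  rw [map_zero, map_add, map_sum, Finset.sum_eq_zero] at h2
  · simpa using h2.symm
  · intro j _
    have : toCoinv n (esym Finset.univ (j + 1)) = 0 :=
      toCoinv_eq_zero_iff.2 (mem_symIdeal_of_symmetric (fun w => rename_esym (by simp) _)
        (Nat.succ_pos j) (esym_isHomogeneous _ _))
    rw [map_mul, map_mul, this, zero_mul, mul_zero]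

/-- C is of finite type and generated by nilpotents. Finite dimension is what later reduces
bijectivity of the Poincaré map to injectivity. -/
instance finite_coinv : Module.Finite ℂ (Coinv n) := by
  have h1 : Algebra.FiniteType ℂ (Coinv n) :=
    Algebra.FiniteType.of_surjective (toCoinv n) toCoinv_surjective
  have h2 : Algebra.IsIntegral ℂ (Coinv n) := by
    refine ⟨fun x => ?_⟩
    obtain ⟨f, rfl⟩ := toCoinv_surjective x
    induction f using MvPolynomial.induction_on with
    | C a => exact isIntegral_algebraMap (A := Coinv n) (x := a)
    | add p q hp hq => rw [map_add]; exact hp.add hq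
    | mul_X p i hp =>
      rw [map_mul]
      refine hp.mul (IsIntegral.of_pow (n := n) (i.pos) ?_)
      rw [toCoinv_X_pow]
      exact isIntegral_zero
  exact Algebra.IsIntegral.finite

section descend

variable {M : Type*} [AddCommGroup M] [Module ℂ M]

/-- A linear map on polynomials that vanishes on the ideal, as a map on `C`. -/
def descend (f : MvPolynomial (Fin n) ℂ →ₗ[ℂ] M) (h : ∀ x ∈ symIdeal n, f x = 0) :
    Coinv n →ₗ[ℂ] M :=
  (LinearMap.ker (toCoinv n).toLinearMap).liftQ f (fun x hx => h x (toCoinv_eq_zero_iff.1 hx)) ∘ₗ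
    ((toCoinv n).toLinearMap.quotKerEquivOfSurjective toCoinv_surjective).symm.toLinearMap

theorem descend_toCoinv (f : MvPolynomial (Fin n) ℂ →ₗ[ℂ] M) (h : ∀ x ∈ symIdeal n, f x = 0)
    (x : MvPolynomial (Fin n) ℂ) : descend f h (toCoinv n x) = f x := by
  have h2 : ((toCoinv n).toLinearMap.quotKerEquivOfSurjective toCoinv_surjective).symm
      (toCoinv n x) = Submodule.Quotient.mk x := by
    rw [LinearEquiv.symm_apply_eq]
    rfl
  rw [descend, LinearMap.comp_apply, LinearEquiv.coe_coe, h2]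
  rfl

end descend

/-! ### Operators that descend to the coinvariant algebra. -/

/-- Reduces statements about the ideal to products s a with s symmetric. Operators linear over
symmetric polynomials, such as D_H and divided differences, are thereby seen to preserve the ideal.
-/
theorem symIdeal_induction {p : MvPolynomial (Fin n) ℂ → Prop} (h0 : p 0)
    (hadd : ∀ f g, p f → p g → p (f + g))
    (hmul : ∀ a s : MvPolynomial (Fin n) ℂ, s.IsSymmetric → s ∈ symIdeal n → p (s * a))
    {f : MvPolynomial (Fin n) ℂ} (hf : f ∈ symIdeal n) : p f := by
  suffices h : ∀ a, p (f * a) by simpa using h 1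
  refine Submodule.span_induction (p := fun f _ => ∀ a, p (f * a)) ?_ ?_ ?_ ?_ hf
  · intro s hs a
    exact hmul a s hs.1 (Ideal.subset_span hs)
  · intro a
    rwa [zero_mul]
  · intro x y _ _ hx hy a
    rw [add_mul]
    exact hadd _ _ (hx a) (hy a)
  · intro b x _ hx a
    rw [smul_eq_mul, mul_comm b, mul_assoc]
    exact hx _

theorem Parab.dem_mem_symIdeal {H : Subgroup (Equiv.Perm (Fin n))} (hH : Parab H)
    {f : MvPolynomial (Fin n) ℂ} (hf : f ∈ symIdeal n) : dem H f ∈ symIdeal n := by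
  refine symIdeal_induction (p := fun f => dem H f ∈ symIdeal n) ?_ ?_ ?_ hf
  · simp
  · intro f g hf hg
    rw [map_add]
    exact Ideal.add_mem _ hf hg
  · intro a s hs hm
    rw [hH.dem_mul fun w _ => hs w]
    exact Ideal.mul_mem_right _ _ hm

/-- The image in `C` of the product of the differences `x_i - x_j` over the pairs `i < j` in
one `H`-orbit. -/
def eps (H : Subgroup (Equiv.Perm (Fin n))) : Coinv n := toCoinv n (epsPoly H)

open Classical in
/-- The Demazure operator of `H` on `C`. -/
def ddem (H : Subgroup (Equiv.Perm (Fin n))) : Coinv n →ₗ[ℂ] Coinv n :=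
  if h : Parab H then
    descend ((toCoinv n).toLinearMap ∘ₗ dem H)
      (fun _ hx => toCoinv_eq_zero_iff.2 (h.dem_mem_symIdeal hx))
  else 0

open Classical in
/-- The average of a polynomial over a group of permutations. -/
def avgPoly (H : Subgroup (Equiv.Perm (Fin n))) (f : MvPolynomial (Fin n) ℂ) :
    MvPolynomial (Fin n) ℂ :=
  (1 / (Nat.card H : ℂ)) • ∑ w : Equiv.Perm (Fin n) with w ∈ H, rename w f

theorem card_ne_zero (H : Subgroup (Equiv.Perm (Fin n))) : (Nat.card H : ℂ) ≠ 0 :=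
  Nat.cast_ne_zero.2 Nat.card_pos.ne'

theorem rename_avgPoly {H : Subgroup (Equiv.Perm (Fin n))} {u : Equiv.Perm (Fin n)}
    (hu : u ∈ H) (f : MvPolynomial (Fin n) ℂ) : rename u (avgPoly H f) = avgPoly H f := by
  classical
  rw [avgPoly, map_smul, map_sum, ← sum_mul_left_mem hu fun w => rename w f]
  simp_rw [rename_mul]

open Classical in
theorem toCoinv_avgPoly (H : Subgroup (Equiv.Perm (Fin n))) (f : MvPolynomial (Fin n) ℂ) :
    toCoinv n (avgPoly H f) = (1 / (Nat.card H : ℂ)) •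
      ∑ w : Equiv.Perm (Fin n) with w ∈ H, perm w (toCoinv n f) := by
  rw [avgPoly, map_smul, map_sum]
  rfl

theorem toCoinv_avgPoly_of_mem {H : Subgroup (Equiv.Perm (Fin n))} {f : MvPolynomial (Fin n) ℂ}
    (hf : toCoinv n f ∈ inv H) : toCoinv n (avgPoly H f) = toCoinv n f := by
  classical
  rw [toCoinv_avgPoly, Finset.sum_congr rfl (g := fun _ => toCoinv n f), Finset.sum_const,
    card_filter_mem, ← Nat.cast_smul_eq_nsmul ℂ, smul_smul, one_div,
    inv_mul_cancel₀ (card_ne_zero H), one_smul]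
  intro w hw
  exact hf w (by simpa using hw)

/-- Averaging a lift over the group, possible in characteristic zero; invariants of C thus come from
invariant polynomials. -/
theorem exists_invariant_lift {H : Subgroup (Equiv.Perm (Fin n))} {x : Coinv n}
    (hx : x ∈ inv H) : ∃ f, (∀ w ∈ H, rename w f = f) ∧ toCoinv n f = x := by
  obtain ⟨f, rfl⟩ := toCoinv_surjective x
  exact ⟨avgPoly H f, fun w hw => rename_avgPoly hw f, toCoinv_avgPoly_of_mem hx⟩

theorem toCoinv_mem_inv {H : Subgroup (Equiv.Perm (Fin n))} {f : MvPolynomial (Fin n) ℂ}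
    (hf : ∀ w ∈ H, rename w f = f) : toCoinv n f ∈ inv H := by
  intro w hw
  rw [perm_toCoinv, hf w hw]

theorem twist_apply (w : Equiv.Perm (Fin n)) (x : Coinv n) : twist w x = sgn w • perm w x := rfl

namespace Parab

variable {H : Subgroup (Equiv.Perm (Fin n))} (hH : Parab H)
include hH

theorem ddem_toCoinv (f : MvPolynomial (Fin n) ℂ) :
    ddem H (toCoinv n f) = toCoinv n (dem H f) := by
  rw [ddem, dif_pos hH]
  exact descend_toCoinv ((toCoinv n).toLinearMap ∘ₗ dem H) _ f

open Classical in
theorem eps_mul_ddem (x : Coinv n) :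
    eps H * ddem H x = ∑ w : Equiv.Perm (Fin n) with w ∈ H, twist w x := by
  obtain ⟨f, rfl⟩ := toCoinv_surjective x
  rw [hH.ddem_toCoinv, eps, ← map_mul, hH.epsPoly_mul_dem, antisym_apply, map_sum]
  refine Finset.sum_congr rfl fun w _ => ?_
  rw [map_smul]
  rfl

theorem perm_eps {w : Equiv.Perm (Fin n)} (hw : w ∈ H) : perm w (eps H) = sgn w • eps H := by
  rw [eps, perm_toCoinv, hH.rename_epsPoly hw, map_smul]

theorem ddem_mem (x : Coinv n) : ddem H x ∈ inv H := by
  obtain ⟨f, rfl⟩ := toCoinv_surjective x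
  rw [hH.ddem_toCoinv]
  exact toCoinv_mem_inv fun w hw => hH.rename_dem hw f

theorem ddem_mul {z : Coinv n} (hz : z ∈ inv H) (x : Coinv n) :
    ddem H (z * x) = z * ddem H x := by
  obtain ⟨f, rfl⟩ := toCoinv_surjective x
  obtain ⟨s, hs, rfl⟩ := exists_invariant_lift hz
  rw [← map_mul, hH.ddem_toCoinv, hH.ddem_toCoinv, hH.dem_mul hs, map_mul]

theorem ddem_perm {w : Equiv.Perm (Fin n)} (hw : w ∈ H) (x : Coinv n) :
    ddem H (perm w x) = sgn w • ddem H x := by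
  obtain ⟨f, rfl⟩ := toCoinv_surjective x
  rw [perm_toCoinv, hH.ddem_toCoinv, hH.ddem_toCoinv, hH.dem_rename hw, map_smul]

theorem ddem_twist {w : Equiv.Perm (Fin n)} (hw : w ∈ H) (x : Coinv n) :
    ddem H (twist w x) = ddem H x := by
  rw [twist_apply, map_smul, hH.ddem_perm hw, smul_smul, sgn_mul_self, one_smul]

theorem ddem_eps : ddem H (eps H) = algebraMap ℂ _ (Nat.card H : ℂ) := by
  rw [eps, hH.ddem_toCoinv, hH.dem_epsPoly]
  exact (toCoinv n).commutes _

theorem ddem_mul_eps {z : Coinv n} (hz : z ∈ inv H) :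
    ddem H (z * eps H) = (Nat.card H : ℂ) • z := by
  rw [hH.ddem_mul hz, hH.ddem_eps, mul_comm, algebraMap_mul]

/-- D_H recovers |H| z from z ε_H, so multiplication by ε_H is injective on invariants and
identities in C^H can be checked in C. -/
theorem eq_zero_of_mul_eps {z : Coinv n} (hz : z ∈ inv H) (h : z * eps H = 0) : z = 0 := by
  have h2 := hH.ddem_mul_eps hz
  rw [h, map_zero] at h2
  exact (smul_eq_zero.1 h2.symm).resolve_left (card_ne_zero H)

end Parab

/-! ### The top degree of `C` -/

/-- The homogeneous components of positive degree of a symmetric lift lie in the ideal. -/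
theorem eq_algebraMap_of_mem_inv_top {x : Coinv n}
    (hx : x ∈ inv (⊤ : Subgroup (Equiv.Perm (Fin n)))) : ∃ c : ℂ, x = algebraMap ℂ _ c := by
  obtain ⟨f, hf, rfl⟩ := exists_invariant_lift hx
  refine ⟨coeff 0 f, ?_⟩
  conv_lhs => rw [← sum_homogeneousComponent f]
  rw [Finset.sum_range_succ', homogeneousComponent_zero, map_add, map_sum, Finset.sum_eq_zero,
    zero_add]
  · exact (toCoinv n).commutes _
  · intro d _
    refine toCoinv_eq_zero_iff.2 (mem_symIdeal_of_symmetric (fun w => ?_) (Nat.succ_pos d)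
      (homogeneousComponent_isHomogeneous _ _))
    rw [rename_homogeneousComponent, hf w trivial]

theorem exists_divided_difference (i j : Fin n) {f : MvPolynomial (Fin n) ℂ}
    (hf : f ∈ symIdeal n) :
    ∃ g ∈ symIdeal n, f - rename (Equiv.swap i j) f = (X i - X j) * g := by
  refine symIdeal_induction (p := fun f => ∃ g ∈ symIdeal n,
    f - rename (Equiv.swap i j) f = (X i - X j) * g) ?_ ?_ ?_ hf
  · exact ⟨0, Ideal.zero_mem _, by simp⟩
  · rintro f f' ⟨g, hg, h⟩ ⟨g', hg', h'⟩
    refine ⟨g + g', Ideal.add_mem _ hg hg', ?_⟩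
    rw [map_add, mul_add, ← h, ← h']
    ring
  · intro a s hs hm
    obtain ⟨g, hg⟩ := X_sub_X_dvd_sub_rename_swap i j a
    refine ⟨s * g, Ideal.mul_mem_right _ _ hm, ?_⟩
    rw [map_mul, hs, ← mul_sub, hg]
    ring

/-- Write ∂ for the divided difference (f - (i j) f) / (x_i - x_j). For a lift f of z both x_i f and
x_j f lie in the ideal, which ∂ preserves; and ∂(x_i f) - ∂(x_j f) = f + (i j) f. -/
theorem perm_swap_of_socle {z : Coinv n} (hz : ∀ i, toCoinv n (X i) * z = 0) {i j : Fin n}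
    (hij : i ≠ j) : perm (Equiv.swap i j) z = -z := by
  obtain ⟨f, rfl⟩ := toCoinv_surjective z
  obtain ⟨g, hg⟩ := X_sub_X_dvd_sub_rename_swap i j f
  have hm : ∀ l, X l * f ∈ symIdeal n := fun l => by
    rw [← toCoinv_eq_zero_iff, map_mul, hz]
  obtain ⟨g1, hg1, h1⟩ := exists_divided_difference i j (hm i)
  obtain ⟨g2, hg2, h2⟩ := exists_divided_difference i j (hm j)
  rw [map_mul, rename_X, Equiv.swap_apply_left] at h1
  rw [map_mul, rename_X, Equiv.swap_apply_right] at h2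
  have hd := X_sub_X_ne_zero hij
  have e1 : g1 = f + X j * g := by
    refine mul_left_cancel₀ hd ?_
    rw [← h1]
    linear_combination (X j) * hg
  have e2 : g2 = -f + X i * g := by
    refine mul_left_cancel₀ hd ?_
    rw [← h2]
    linear_combination (X i) * hg
  have h3 : f + rename (Equiv.swap i j) f = g1 - g2 := by
    rw [e1, e2]
    linear_combination -hg
  rw [perm_toCoinv, eq_neg_iff_add_eq_zero, ← map_add, toCoinv_eq_zero_iff, add_comm, h3]
  exact Ideal.sub_mem _ hg1 hg2

/-- A socle element is alternating, so n! z is the Vandermonde product times D(z), and D(z) is a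
symmetric element of C, that is, a scalar. -/
theorem exists_smul_eps_of_socle {z : Coinv n} (hz : ∀ i, toCoinv n (X i) * z = 0) :
    ∃ c : ℂ, z = c • eps ⊤ := by
  classical
  have hp : ∀ w : Equiv.Perm (Fin n), twist w z = z := by
    intro w
    induction w using Equiv.Perm.swap_induction_on' with
    | one =>
      obtain ⟨f, rfl⟩ := toCoinv_surjective z
      rw [twist_apply, sgn_one, one_smul, perm_toCoinv]
      exact congrArg _ (rename_id_apply f)
    | mul_swap w x y hxy ih =>
      rw [twist_mul, twist_apply (Equiv.swap x y), perm_swap_of_socle hz hxy, sgn_swap hxy,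
        neg_one_smul, neg_neg, ih]
  have h := parab_top.eps_mul_ddem z
  rw [Finset.sum_congr rfl fun w _ => hp w, Finset.sum_const, card_filter_mem,
    ← Nat.cast_smul_eq_nsmul ℂ] at h
  obtain ⟨c, hc⟩ := eq_algebraMap_of_mem_inv_top (parab_top.ddem_mem z)
  refine ⟨(Nat.card (⊤ : Subgroup (Equiv.Perm (Fin n))) : ℂ)⁻¹ * c, ?_⟩
  rw [mul_smul, ← algebraMap_mul c, ← hc, mul_comm, h, smul_smul,
    inv_mul_cancel₀ (card_ne_zero _), one_smul]

/-- The integration functional on `C`, up to a factor. -/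
def int0 : Coinv n →ₗ[ℂ] ℂ :=
  descend (lcoeff ℂ 0 ∘ₗ dem ⊤) (fun x hx => by
    refine symIdeal_induction (p := fun f => coeff 0 f = 0) (by simp) ?_ ?_
      (parab_top.dem_mem_symIdeal hx)
    · intro f g hf hg
      rw [coeff_add, hf, hg, add_zero]
    · intro a s _ hm
      -- D preserves the ideal, and elements of the ideal have no constant term; so the functional
      -- is well defined on C.
      have h : symIdeal n ≤ RingHom.ker (constantCoeff : MvPolynomial (Fin n) ℂ →+* ℂ) := by
        refine Ideal.span_le.2 ?_
        rintro f ⟨_, d, hd, hf⟩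
        change coeff 0 f = 0
        exact hf.coeff_eq_zero (by simpa using hd.ne)
      have h2 : constantCoeff s = 0 := h hm
      change constantCoeff (s * a) = 0
      rw [map_mul, h2, zero_mul])

theorem int0_toCoinv (f : MvPolynomial (Fin n) ℂ) : int0 (toCoinv n f) = coeff 0 (dem ⊤ f) := by
  exact descend_toCoinv (lcoeff ℂ 0 ∘ₗ dem ⊤) _ f

theorem int0_perm (w : Equiv.Perm (Fin n)) (x : Coinv n) :
    int0 (perm w x) = sgn w * int0 x := by
  obtain ⟨f, rfl⟩ := toCoinv_surjective x
  rw [perm_toCoinv, int0_toCoinv, int0_toCoinv, parab_top.dem_rename trivial, coeff_smul,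
    smul_eq_mul]

theorem int0_eps : int0 (eps (⊤ : Subgroup (Equiv.Perm (Fin n)))) = (n.factorial : ℂ) := by
  rw [eps, int0_toCoinv, parab_top.dem_epsPoly, coeff_C, if_pos rfl, Nat.card_congr
    Subgroup.topEquiv.toEquiv, Nat.card_eq_fintype_card, Fintype.card_perm, Fintype.card_fin]

theorem int0_of_isHomogeneous {f : MvPolynomial (Fin n) ℂ} {d : ℕ} (hf : f.IsHomogeneous d)
    (hd : d ≠ (samePairs (⊤ : Subgroup (Equiv.Perm (Fin n)))).card) :
    int0 (toCoinv n f) = 0 := by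
  have h := parab_top.homogeneousComponent_dem_of_ne hf (e := 0) (by simpa using hd.symm)
  rw [homogeneousComponent_zero, map_eq_zero_iff _ (C_injective _ _)] at h
  rw [int0_toCoinv, h]

/-- The ideal of `C` generated by the variables. -/
def varIdeal (n : ℕ) : Ideal (Coinv n) := Ideal.span (Set.range fun i => toCoinv n (X i))

theorem varIdeal_isNilpotent : IsNilpotent (varIdeal n) := by
  classical
  have hfg : (varIdeal n).FG := ⟨Finset.univ.image fun i => toCoinv n (X i), by simp [varIdeal]⟩
  rw [hfg.isNilpotent_iff_le_nilradical, varIdeal, Ideal.span_le]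
  rintro _ ⟨i, rfl⟩
  exact ⟨n, toCoinv_X_pow i⟩

/-- Induction on r with varIdeal^r z = 0. Each x_i z satisfies the hypotheses with r - 1, so it
vanishes and z is in the socle; the socle is spanned by the Vandermonde product, whose integral is
n!. -/
theorem eq_zero_of_int0_mul {z : Coinv n} (h : ∀ y, int0 (z * y) = 0) : z = 0 := by
  obtain ⟨r, hr⟩ := varIdeal_isNilpotent (n := n)
  have h2 : ∀ y ∈ varIdeal n ^ r, y * z = 0 := by
    intro y hy
    rw [hr] at hy
    rw [show y = 0 from hy, zero_mul]
  -- The induction is on the exponent that annihilates the varying z, so the nilpotency equation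
  -- itself must be dropped.
  clear hr
  induction r generalizing z with
  | zero => simpa using h2 1 (by simp)
  | succ r ih =>
    have hs : ∀ i, toCoinv n (X i) * z = 0 := by
      intro i
      refine ih (fun y => ?_) fun y hy => ?_
      · rw [mul_comm _ z, mul_assoc]
        exact h _
      · rw [← mul_assoc]
        refine h2 _ ?_
        rw [show varIdeal n ^ (r + 1) = varIdeal n ^ r * varIdeal n from Submodule.pow_succ _]
        exact Ideal.mul_mem_mul hy (Ideal.subset_span ⟨i, rfl⟩)
    obtain ⟨c, rfl⟩ := exists_smul_eps_of_socle hs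
    have h3 := h 1
    rw [mul_one, map_smul, int0_eps, smul_eq_mul] at h3
    rw [(mul_eq_zero.1 h3).resolve_right (Nat.cast_ne_zero.2 n.factorial_ne_zero), zero_smul]

/-- In top degree, `C` is spanned by the Vandermonde product. -/
theorem exists_smul_eps_of_isHomogeneous {f : MvPolynomial (Fin n) ℂ}
    (hf : f.IsHomogeneous (samePairs (⊤ : Subgroup (Equiv.Perm (Fin n)))).card) :
    toCoinv n f = (int0 (toCoinv n f) / (n.factorial : ℂ)) • eps ⊤ := by
  have hn : (n.factorial : ℂ) ≠ 0 := Nat.cast_ne_zero.2 n.factorial_ne_zero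
  set c := int0 (toCoinv n f) / (n.factorial : ℂ) with hc
  rw [← sub_eq_zero]
  refine eq_zero_of_int0_mul fun y => ?_
  obtain ⟨g, rfl⟩ := toCoinv_surjective y
  have he : toCoinv n f - c • eps ⊤ = toCoinv n (f - c • epsPoly ⊤) := by
    rw [map_sub, map_smul]; rfl
  have hh : (f - c • epsPoly ⊤).IsHomogeneous
      (samePairs (⊤ : Subgroup (Equiv.Perm (Fin n)))).card := by
    rw [smul_eq_C_mul]
    exact hf.sub ((epsPoly_isHomogeneous _).C_mul _)
  -- Components of g of positive degree push the product above the top degree; for the constant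
  -- component the integral vanishes by the choice of c.
  rw [he, ← sum_homogeneousComponent g, map_sum, Finset.mul_sum, map_sum]
  refine Finset.sum_eq_zero fun d _ => ?_
  by_cases hd : d = 0
  · subst hd
    have h0 : toCoinv n (C (coeff 0 g)) = algebraMap ℂ _ (coeff 0 g) := (toCoinv n).commutes _
    rw [homogeneousComponent_zero, h0, ← he, mul_comm, algebraMap_mul, map_smul, map_sub,
      map_smul, int0_eps, hc, smul_eq_mul (_ / _), div_mul_cancel₀ _ hn, sub_self, smul_zero]
  · rw [← map_mul]
    exact int0_of_isHomogeneous (hh.mul (homogeneousComponent_isHomogeneous d g)) (by omega)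

/-! ### Poincaré duality -/

/-- The integration functional on `C^H`, in terms of that on `C`. -/
def intH (H : Subgroup (Equiv.Perm (Fin n))) : inv H →ₗ[ℂ] ℂ :=
  (1 / (Nat.card H : ℂ)) •
    (int0 ∘ₗ LinearMap.mulRight ℂ (eps H) ∘ₗ (inv H).val.toLinearMap)

theorem intH_apply (H : Subgroup (Equiv.Perm (Fin n))) (x : inv H) :
    intH H x = 1 / (Nat.card H : ℂ) * int0 ((x : Coinv n) * eps H) := rfl

theorem toCoinv_pointPoly (H : Subgroup (Equiv.Perm (Fin n))) :
    toCoinv n (pointPoly H) =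
      ((Nat.card H : ℂ) / (n.factorial : ℂ)) • toCoinv n (crossPoly H) := by
  rw [← algebraMap_mul, pointPoly, map_mul]
  congr 1

theorem factorial_ne_zero' : (n.factorial : ℂ) ≠ 0 := Nat.cast_ne_zero.2 n.factorial_ne_zero

theorem toCoinv_crossPoly_mul_eps (H : Subgroup (Equiv.Perm (Fin n))) :
    toCoinv n (crossPoly H) * eps H = eps ⊤ := by
  rw [eps, ← map_mul, ← epsPoly_top, eps]

namespace Parab

variable {H : Subgroup (Equiv.Perm (Fin n))} (hH : Parab H)
include hH

theorem toCoinv_pointPoly_mem : toCoinv n (pointPoly H) ∈ inv H := by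
  rw [toCoinv_pointPoly]
  exact (inv H).smul_mem (toCoinv_mem_inv fun w hw => hH.rename_crossPoly hw) _

theorem isIntegral_intH : IsIntegral H (intH H) := by
  refine ⟨⟨⟨_, hH.toCoinv_pointPoly_mem⟩, rfl, ?_⟩, ?_⟩
  · rw [intH_apply]
    change 1 / (Nat.card H : ℂ) * int0 (toCoinv n (pointPoly H) * eps H) = 1
    rw [toCoinv_pointPoly, smul_mul_assoc, toCoinv_crossPoly_mul_eps, map_smul, int0_eps,
      smul_eq_mul, div_mul_cancel₀ _ factorial_ne_zero', one_div,
      inv_mul_cancel₀ (card_ne_zero H)]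
  · intro d f hd hf x hx
    rw [intH_apply, hx, eps, ← map_mul, int0_of_isHomogeneous (hf.mul (epsPoly_isHomogeneous H)),
      mul_zero]
    rw [card_samePairs_top H]
    omega

/-- Multiplication by ε_H carries the claim to the top degree of C, which is one-dimensional, and
can be cancelled on invariants. The factor n! / |H| undoes the normalisation in `pointPoly`. -/
theorem exists_smul_pointPoly {f : MvPolynomial (Fin n) ℂ} (hf : ∀ w ∈ H, rename w f = f)
    (hd : f.IsHomogeneous (crossPairs H).card) :
    ∃ c : ℂ, toCoinv n f = c • toCoinv n (pointPoly H) := by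
  have h := exists_smul_eps_of_isHomogeneous (f := f * epsPoly H) (by
    rw [card_samePairs_top H]
    exact hd.mul (epsPoly_isHomogeneous H))
  set c := int0 (toCoinv n (f * epsPoly H)) / (n.factorial : ℂ)
  refine ⟨c * ((n.factorial : ℂ) / (Nat.card H : ℂ)), ?_⟩
  have hc : c * ((n.factorial : ℂ) / (Nat.card H : ℂ)) * ((Nat.card H : ℂ) / n.factorial) = c := by
    have := card_ne_zero H
    have := factorial_ne_zero' (n := n)
    field_simp
  rw [toCoinv_pointPoly, smul_smul, hc, ← sub_eq_zero]
  refine hH.eq_zero_of_mul_eps ?_ ?_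
  · exact (inv H).sub_mem (toCoinv_mem_inv hf)
      ((inv H).smul_mem (toCoinv_mem_inv fun w hw => hH.rename_crossPoly hw) _)
  · rw [sub_mul, smul_mul_assoc, toCoinv_crossPoly_mul_eps, ← h, map_mul]
    exact sub_self _

/-- Homogeneous components of an invariant lift are again invariant, so C^H is spanned by
homogeneous invariants, and those of top degree are multiples of the class of a point. -/
theorem isIntegral_unique {φ ψ : inv H →ₗ[ℂ] ℂ} (hφ : IsIntegral H φ) (hψ : IsIntegral H ψ) :
    φ = ψ := by
  have key : ∀ (d : ℕ) (f : MvPolynomial (Fin n) ℂ) (hf : ∀ w ∈ H, rename w f = f),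
      f.IsHomogeneous d → φ ⟨_, toCoinv_mem_inv hf⟩ = ψ ⟨_, toCoinv_mem_inv hf⟩ := by
    intro d f hf hd
    by_cases h : d = (crossPairs H).card
    · obtain ⟨c, hc⟩ := hH.exists_smul_pointPoly hf (h ▸ hd)
      obtain ⟨⟨x, hx, hx1⟩, -⟩ := hφ
      obtain ⟨⟨y, hy, hy1⟩, -⟩ := hψ
      have e : (⟨_, toCoinv_mem_inv hf⟩ : inv H) = c • x := Subtype.ext (hc.trans (by rw [← hx]; rfl))
      have e2 : x = y := Subtype.ext (hx.trans hy.symm)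
      rw [e, map_smul, map_smul, hx1, e2, hy1]
    · rw [hφ.2 d f h hd _ rfl, hψ.2 d f h hd _ rfl]
  refine LinearMap.ext fun z => ?_
  obtain ⟨f, hf, hz⟩ := exists_invariant_lift z.2
  have hr : ∀ d, ∀ w ∈ H, rename w (homogeneousComponent d f) = homogeneousComponent d f := by
    intro d w hw
    rw [rename_homogeneousComponent, hf w hw]
  have hs : z = ∑ d ∈ Finset.range (f.totalDegree + 1),
      (⟨_, toCoinv_mem_inv (hr d)⟩ : inv H) := by
    refine Subtype.ext ?_
    rw [AddSubmonoidClass.coe_finsetSum, ← map_sum, sum_homogeneousComponent, hz]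
  rw [hs, map_sum, map_sum]
  exact Finset.sum_congr rfl fun d _ => key d _ (hr d) (homogeneousComponent_isHomogeneous _ _)

theorem integral_eq : integral H = intH H := by
  have h : ∃ φ, IsIntegral H φ := ⟨_, hH.isIntegral_intH⟩
  rw [integral, dif_pos h]
  exact hH.isIntegral_unique h.choose_spec hH.isIntegral_intH

theorem poincare_apply (x y : inv H) : poincare H x y = intH H (x * y) := by
  rw [← hH.integral_eq]
  rfl

/-- The adjunction behind the push-forward formula: ε_H D_H(x) is the signed sum of the w x, and
after multiplication by the invariant z all |H| terms have the same integral. -/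
theorem int0_mul_ddem {z : Coinv n} (hz : z ∈ inv H) (x : Coinv n) :
    int0 (ddem H x * z * eps H) = (Nat.card H : ℂ) * int0 (x * z) := by
  classical
  rw [mul_comm _ (eps H), ← mul_assoc, hH.eps_mul_ddem, Finset.sum_mul, map_sum,
    Finset.sum_congr rfl (g := fun _ => int0 (x * z)), Finset.sum_const, card_filter_mem,
    nsmul_eq_mul]
  intro w hw
  have h : twist w x * z = sgn w • perm w (x * z) := by
    rw [twist_apply, map_mul, hz w (by simpa using hw), smul_mul_assoc]
  rw [h, map_smul, int0_perm, smul_eq_mul, ← mul_assoc, sgn_mul_self, one_mul]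

/-- Testing z against D_H(y ε_H) amounts, by the adjunction, to testing z ε_H against an arbitrary y
in C. -/
theorem intH_nondegenerate {z : inv H} (h : ∀ y, intH H (z * y) = 0) : z = 0 := by
  refine Subtype.ext (hH.eq_zero_of_mul_eps z.2 (eq_zero_of_int0_mul fun y => ?_))
  have h1 := h ⟨_, hH.ddem_mem (y * eps H)⟩
  rw [intH_apply] at h1
  have h2 := (mul_eq_zero.1 h1).resolve_left (one_div_ne_zero (card_ne_zero H))
  have h3 := hH.int0_mul_ddem z.2 (y * eps H)
  have h4 : ((z * ⟨_, hH.ddem_mem (y * eps H)⟩ : inv H) : Coinv n) * eps H =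
      ddem H (y * eps H) * z * eps H := by
    rw [mul_comm (ddem H _)]; rfl
  rw [← h4, h2] at h3
  have h5 := (mul_eq_zero.1 h3.symm).resolve_left (card_ne_zero H)
  rw [← h5]
  congr 1
  ring

theorem poincare_bijective : Function.Bijective (poincare H) := by
  have hfin : FiniteDimensional ℂ (inv H) :=
    inferInstanceAs (FiniteDimensional ℂ (Subalgebra.toSubmodule (inv H)))
  have hinj : Function.Injective (poincare H) := by
    refine (injective_iff_map_eq_zero _).2 fun z hz => hH.intH_nondegenerate fun y => ?_
    rw [← hH.poincare_apply, hz, LinearMap.zero_apply]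
  exact ⟨hinj, (LinearMap.injective_iff_surjective_of_finrank_eq_finrank
    Subspace.dual_finrank_eq.symm).1 hinj⟩

theorem poincareDuality : PoincareDuality H :=
  ⟨⟨_, hH.isIntegral_intH, fun _ h => hH.isIntegral_unique h hH.isIntegral_intH⟩,
    hH.poincare_bijective⟩

theorem poincare_pushforward {K : Subgroup (Equiv.Perm (Fin n))} (h : K ≤ H)
    (z : inv K) (y : inv H) :
    poincare H (pushforward h z) y = poincare K z (pullback h y) := by
  rw [pushforward, dif_pos hH.poincare_bijective]
  exact LinearMap.congr_fun ((LinearEquiv.ofBijective (poincare H)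
    hH.poincare_bijective).apply_symm_apply
      ((pullback h).toLinearMap.dualMap (poincare K z))) y

/-- The push-forward in terms of the Demazure operator. -/
theorem coe_pushforward {K : Subgroup (Equiv.Perm (Fin n))} (hK : Parab K) (h : K ≤ H)
    (z : inv K) : (pushforward h z : Coinv n) =
      (1 / (Nat.card K : ℂ)) • ddem H ((z : Coinv n) * eps K) := by
  set u : inv H := ⟨_, (inv H).smul_mem (hH.ddem_mem ((z : Coinv n) * eps K))
    (1 / (Nat.card K : ℂ))⟩ with hu
  suffices hz : pushforward h z = u from congrArg Subtype.val hz
  refine hH.poincare_bijective.1 (LinearMap.ext fun y => ?_)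
  rw [hH.poincare_pushforward, hH.poincare_apply, hK.poincare_apply, intH_apply, intH_apply]
  have h1 : ((z * pullback h y : inv K) : Coinv n) = (z : Coinv n) * (y : Coinv n) := rfl
  have h2 : ((u * y : inv H) : Coinv n) =
    ((1 / (Nat.card K : ℂ)) • ddem H ((z : Coinv n) * eps K)) * (y : Coinv n) := rfl
  rw [h1, h2, smul_mul_assoc, smul_mul_assoc, map_smul, hH.int0_mul_ddem y.2, smul_eq_mul,
    mul_left_comm, ← mul_assoc (1 / (Nat.card H : ℂ)), one_div_mul_cancel (card_ne_zero H), one_mul,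
    mul_right_comm]

end Parab

theorem orbit_bot (i j : Fin n) :
    i ∈ MulAction.orbit (⊥ : Subgroup (Equiv.Perm (Fin n))) j ↔ i = j := by
  rw [mem_orbit_iff]
  constructor
  · rintro ⟨w, hw, rfl⟩
    rw [Subgroup.mem_bot.1 hw]; rfl
  · rintro rfl
    exact ⟨1, Subgroup.one_mem _, rfl⟩

theorem parab_bot : Parab (⊥ : Subgroup (Equiv.Perm (Fin n))) := by
  refine ⟨fun i j h => ?_, fun w hw i j hij _ => ?_⟩
  · rw [(orbit_bot i j).1 h, Equiv.swap_self]
    exact Subgroup.one_mem _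
  · rw [Subgroup.mem_bot.1 hw]
    exact hij

theorem eps_bot : eps (⊥ : Subgroup (Equiv.Perm (Fin n))) = 1 := by
  have h : samePairs (⊥ : Subgroup (Equiv.Perm (Fin n))) = ∅ := by
    ext p
    rw [mem_samePairs, orbit_bot]
    simp only [Finset.notMem_empty, iff_false, not_and]
    exact fun h => h.ne
  rw [eps, epsPoly, h, Finset.prod_empty, map_one]

/-! ### Young subgroups -/

theorem swap_mem_young {ν : Comp n} {i j : Fin n} (h : word ν i = word ν j) :
    Equiv.swap i j ∈ young ν := by
  intro l
  rw [Equiv.swap_apply_def]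
  split_ifs with h1 h2
  · rw [h1, h]
  · rw [h2, h]
  · rfl

theorem orbit_young {ν : Comp n} {i j : Fin n} :
    i ∈ MulAction.orbit (young ν) j ↔ word ν i = word ν j := by
  rw [mem_orbit_iff]
  constructor
  · rintro ⟨w, hw, rfl⟩
    exact hw j
  · intro h
    exact ⟨_, swap_mem_young h.symm, Equiv.swap_apply_left _ _⟩

theorem orbit_young_inf {ν ν' : Comp n} {i j : Fin n} :
    i ∈ MulAction.orbit ↑(young ν ⊓ young ν') j ↔
      word ν i = word ν j ∧ word ν' i = word ν' j := by
  rw [mem_orbit_iff]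
  constructor
  · rintro ⟨w, hw, rfl⟩
    exact ⟨hw.1 j, hw.2 j⟩
  · intro h
    exact ⟨_, ⟨swap_mem_young h.1.symm, swap_mem_young h.2.symm⟩, Equiv.swap_apply_left _ _⟩

theorem parab_young (ν : Comp n) : Parab (young ν) := by
  refine ⟨fun i j h => swap_mem_young (orbit_young.1 h), fun w hw i j hij h => ?_⟩
  rw [orbit_young] at h
  refine (word_monotone ν).reflect_lt ?_
  rw [hw, hw]
  exact lt_of_le_of_ne (word_monotone ν hij.le) h

theorem parab_young_inf (ν ν' : Comp n) : Parab (young ν ⊓ young ν') := by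
  refine ⟨fun i j h => ?_, fun w hw i j hij h => ?_⟩
  · rw [orbit_young_inf] at h
    exact ⟨swap_mem_young h.1, swap_mem_young h.2⟩
  · rw [orbit_young_inf, not_and_or] at h
    rcases h with h | h
    · refine (word_monotone ν).reflect_lt ?_
      rw [hw.1, hw.1]
      exact lt_of_le_of_ne (word_monotone ν hij.le) h
    · refine (word_monotone ν').reflect_lt ?_
      rw [hw.2, hw.2]
      exact lt_of_le_of_ne (word_monotone ν' hij.le) h

/-! ### Words -/

theorem toMultiset_typ (c : Fin n → ℤ) :
    (Finset.univ : Finset (Fin n)).val.map c = (typ c).1.toMultiset := by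
  change _ = Finsupp.toMultiset (∑ j, Finsupp.single (c j) 1)
  rw [map_sum]
  simp only [Finsupp.toMultiset_single, one_smul]
  exact (Multiset.sum_map_singleton (Finset.univ.val.map c)).symm.trans
    (by rw [Multiset.map_map]; rfl)

theorem eq_word_of_monotone {ν : Comp n} {c : Fin n → ℤ} (hc : Monotone c) (h : typ c = ν) :
    c = word ν := by
  have h1 : (List.ofFn c : Multiset ℤ) = (List.ofFn (word ν) : Multiset ℤ) := by
    rw [← Fin.univ_val_map, ← Fin.univ_val_map, map_word, toMultiset_typ, h]
  exact List.ofFn_injective ((Multiset.coe_eq_coe.1 h1).eq_of_sortedLE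
    (List.sortedLE_ofFn_iff.2 hc) (List.sortedLE_ofFn_iff.2 (word_monotone ν)))

theorem exists_word_comp (b : Fin n → ℤ) :
    ∃ w : Equiv.Perm (Fin n), ∀ j, word (typ b) (w j) = b j := by
  have h := eq_word_of_monotone (Tuple.monotone_sort b) (typ_comp b (Tuple.sort b))
  refine ⟨(Tuple.sort b)⁻¹, fun j => ?_⟩
  rw [← h]
  exact congrArg b ((Tuple.sort b).apply_symm_apply j)

open Classical in
-- The permutations that sort b form a coset of the parabolic subgroup.
theorem card_filter_word (b : Fin n → ℤ) :
    (Finset.univ.filter fun w : Equiv.Perm (Fin n) => ∀ j, word (typ b) (w j) = b j).card =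
      Nat.card (young (typ b)) := by
  obtain ⟨w, hw⟩ := exists_word_comp b
  rw [← card_filter_mem]
  refine Finset.card_bij' (fun u _ => u * w⁻¹) (fun u _ => u * w) ?_ ?_ ?_ ?_
  · intro u hu
    simp only [Finset.mem_filter, Finset.mem_univ, true_and] at hu ⊢
    intro j
    rw [Equiv.Perm.mul_apply, hu, ← hw]
    exact congrArg _ (w.apply_symm_apply j)
  · intro u hu
    simp only [Finset.mem_filter, Finset.mem_univ, true_and] at hu ⊢
    intro j
    rw [Equiv.Perm.mul_apply, hu, hw]
  · intro u _; simp
  · intro u _; simp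

/-! ### Bijectivity of `φ` -/

/-- The class of `v_{b_1} ⊗ ⋯ ⊗ v_{b_n} ⊗ m`. -/
def tensClass (b : Fin n → ℤ) : Coinv n →ₗ[ℂ] TensCoinv n :=
  (balanced n).mkQ ∘ₗ TensorProduct.mk ℂ (Tens n) (Coinv n) (tensBasis n b)

theorem tensClass_apply (b : Fin n → ℤ) (m : Coinv n) :
    tensClass b m = Submodule.Quotient.mk (tensBasis n b ⊗ₜ[ℂ] m) := rfl

theorem permTens_tensBasis (w : Equiv.Perm (Fin n)) (b : Fin n → ℤ) :
    permTens w (tensBasis n b) = tensBasis n fun j => b (w j) := by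
  rw [tensBasis_apply, permTens_tprod, tensBasis_apply]

theorem tensClass_comp (b : Fin n → ℤ) (w : Equiv.Perm (Fin n)) (m : Coinv n) :
    tensClass (fun j => b (w j)) m = tensClass b (twist w m) := by
  rw [tensClass_apply, tensClass_apply, ← permTens_tensBasis, Submodule.Quotient.eq]
  exact Submodule.subset_span ⟨w, _, m, rfl⟩

/-- The inverse of `κ`. -/
def kappaInv (n : ℕ) : (⨁ ν : Comp n, antiInv ν) →ₗ[ℂ] TensCoinv n :=
  DirectSum.toModule ℂ _ _ fun ν => tensClass (word ν) ∘ₗ (antiInv ν).subtype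

theorem kappaInv_lof (ν : Comp n) (m : antiInv ν) :
    kappaInv n (DirectSum.lof ℂ (Comp n) (fun ν => antiInv ν) ν m) =
      tensClass (word ν) (m : Coinv n) := by
  rw [kappaInv, DirectSum.toModule_lof]
  rfl

theorem kappa_tensClass (b : Fin n → ℤ) (m : Coinv n) :
    kappa n (tensClass b m) =
      DirectSum.lof ℂ (Comp n) (fun ν => antiInv ν) (typ b) (kappaWord (typ b) b m) := by
  rw [tensClass_apply, kappa_apply, kappaAux_tmul]

/-- By the balancing relation every summand w m returns the original class; the number of summands
cancels the normalising factor. -/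
theorem kappaInv_kappa (z : TensCoinv n) : kappaInv n (kappa n z) = z := by
  classical
  obtain ⟨z, rfl⟩ := Submodule.Quotient.mk_surjective _ z
  rw [kappa_apply]
  suffices h : kappaInv n ∘ₗ kappaAux n = (balanced n).mkQ from LinearMap.congr_fun h z
  refine TensorProduct.ext ((tensBasis n).ext fun b => LinearMap.ext fun m => ?_)
  change kappaInv n (kappaAux n (tensBasis n b ⊗ₜ[ℂ] m)) = tensClass b m
  rw [kappaAux_tmul, kappaInv_lof, coe_kappaWord, map_smul, map_sum,
    Finset.sum_congr rfl (g := fun _ => tensClass b m), Finset.sum_const, card_filter_word,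
    ← Nat.cast_smul_eq_nsmul ℂ, smul_smul, one_div_mul_cancel (card_ne_zero _), one_smul]
  intro w hw
  rw [← tensClass_comp]
  congr 1
  exact congrArg tensClass (funext (Finset.mem_filter.1 hw).2)

theorem kappaWord_word_of_mem (ν : Comp n) (m : antiInv ν) :
    kappaWord ν (word ν) (m : Coinv n) = m := by
  classical
  refine Subtype.ext ?_
  have h : (Finset.univ.filter fun w : Equiv.Perm (Fin n) => ∀ j, word ν (w j) = word ν j) =
    Finset.univ.filter fun w => w ∈ young ν := Finset.filter_congr fun _ _ => Iff.rfl
  rw [coe_kappaWord, h, Finset.sum_congr rfl (g := fun _ => (m : Coinv n)), Finset.sum_const,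
    card_filter_mem, ← Nat.cast_smul_eq_nsmul ℂ, smul_smul, one_div_mul_cancel (card_ne_zero _),
    one_smul]
  intro w hw
  exact m.2 w (Finset.mem_filter.1 hw).2

theorem kappa_kappaInv (z : ⨁ ν : Comp n, antiInv ν) : kappa n (kappaInv n z) = z := by
  suffices h : kappa n ∘ₗ kappaInv n = LinearMap.id from LinearMap.congr_fun h z
  refine DirectSum.linearMap_ext ℂ fun ν => LinearMap.ext fun m => ?_
  change kappa n (kappaInv n (DirectSum.lof ℂ (Comp n) (fun ν => antiInv ν) ν m)) =
    DirectSum.lof ℂ (Comp n) (fun ν => antiInv ν) ν m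
  rw [kappaInv_lof, kappa_tensClass, typ_word, kappaWord_word_of_mem]

theorem kappa_bijective (n : ℕ) : Function.Bijective (kappa n) :=
  ⟨Function.LeftInverse.injective kappaInv_kappa, Function.RightInverse.surjective kappa_kappaInv⟩

theorem coe_piPush (ν : Comp n) (m : antiInv ν) :
    (piPush ν m : Coinv n) = ddem (young ν) (m : Coinv n) := by
  have h := (parab_young ν).coe_pushforward parab_bot bot_le (toInvBot (m : Coinv n))
  rw [eps_bot, mul_one, Subgroup.card_bot, Nat.cast_one, div_one, one_smul] at h
  exact h

theorem mul_eps_mem_antiInv {ν : Comp n} {f : Coinv n} (hf : f ∈ inv (young ν)) :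
    f * eps (young ν) ∈ antiInv ν := by
  intro w hw
  rw [twist_apply, map_mul, hf w hw, (parab_young ν).perm_eps hw, mul_smul_comm, smul_smul,
    sgn_mul_self, one_smul]

/-- On anti-invariants ε_ν D_ν(m) = |S_ν| m, and on invariants D_ν(f ε_ν) = |S_ν| f; so f ↦ f ε_ν /
|S_ν| is the inverse. -/
theorem piPush_bijective (ν : Comp n) : Function.Bijective (piPush ν) := by
  classical
  constructor
  · refine (injective_iff_map_eq_zero _).2 fun m hm => Subtype.ext ?_
    have h := (parab_young ν).eps_mul_ddem (m : Coinv n)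
    rw [← coe_piPush, hm, ZeroMemClass.coe_zero, mul_zero,
      Finset.sum_congr rfl (g := fun _ => (m : Coinv n)), Finset.sum_const, card_filter_mem,
      ← Nat.cast_smul_eq_nsmul ℂ] at h
    · exact (smul_eq_zero.1 h.symm).resolve_left (card_ne_zero _)
    · intro w hw
      exact m.2 w (Finset.mem_filter.1 hw).2
  · intro f
    refine ⟨(1 / (Nat.card (young ν) : ℂ)) • ⟨_, mul_eps_mem_antiInv f.2⟩, Subtype.ext ?_⟩
    rw [map_smul, SetLike.val_smul, coe_piPush, (parab_young ν).ddem_mul_eps f.2, smul_smul,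
      one_div_mul_cancel (card_ne_zero _), one_smul]

theorem phi_bijective (n : ℕ) : Function.Bijective (phi n) := by
  have h : Function.Bijective (DirectSum.lmap fun ν : Comp n => piPush ν) :=
    ⟨(DirectSum.lmap_injective _).2 fun ν => (piPush_bijective ν).1,
      (DirectSum.lmap_surjective _).2 fun ν => (piPush_bijective ν).2⟩
  exact h.comp (kappa_bijective n)

/-! ### The action of matrix units -/

/-- D_ν is unchanged by the twisted action, so the averaging in κ leaves no trace and m need not be
anti-invariant. This matters because a matrix unit does not produce anti-invariants for the new
composition. -/
theorem phi_tensClass_word (ν : Comp n) (m : Coinv n) :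
    phi n (tensClass (word ν) m) = toSum ν ⟨_, (parab_young ν).ddem_mem m⟩ := by
  classical
  rw [phi, LinearMap.comp_apply, kappa_tensClass, typ_word, DirectSum.lmap_lof, toSum]
  refine congrArg _ (Subtype.ext ?_)
  have h : (Finset.univ.filter fun w : Equiv.Perm (Fin n) => ∀ j, word ν (w j) = word ν j) =
    Finset.univ.filter fun w => w ∈ young ν := Finset.filter_congr fun _ _ => Iff.rfl
  rw [coe_piPush, coe_kappaWord, map_smul, map_sum, h,
    Finset.sum_congr rfl (g := fun _ => ddem (young ν) m), Finset.sum_const,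
    card_filter_mem, ← Nat.cast_smul_eq_nsmul ℂ, smul_smul, one_div_mul_cancel (card_ne_zero _),
    one_smul]
  intro w hw
  exact (parab_young ν).ddem_twist (Finset.mem_filter.1 hw).2 m

theorem tensCoinvRep_tensClass {p q : ℤ} {x : glInf} (hx : x.1 = matrixUnit p q)
    (b : Fin n → ℤ) (m : Coinv n) :
    tensCoinvRep n x (tensClass b m) =
      ∑ j with b j = q, tensClass (Function.update b j p) m := by
  have h : tensRep n x.1 (tensBasis n b) =
      ∑ j with b j = q, tensBasis n (Function.update b j p) := by
    rw [tensBasis_apply, tensRep_tprod, Finset.sum_filter, hx]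
    refine Finset.sum_congr rfl fun j _ => ?_
    rw [matrixUnit_single]
    split_ifs with h
    · rw [tensBasis_apply]
      congr 1
      funext l
      by_cases hl : l = j
      · subst hl; simp
      · simp [hl]
    · exact (PiTensorProduct.tprod ℂ).map_update_zero _ _
  change (balanced n).mapQ (balanced n) ((tensRep n x.1).rTensor (Coinv n))
    (balanced_le_comap x.1) (Submodule.Quotient.mk (tensBasis n b ⊗ₜ[ℂ] m)) = _
  rw [mapQ_comp_mk, LinearMap.rTensor_tmul, h, TensorProduct.sum_tmul]
  exact map_sum (balanced n).mkQ _ _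

/-- The transposition of two positions of one block exchanges the two modified words and fixes m in
the twisted action. -/
theorem tensClass_update_eq {ν : Comp n} {m : Coinv n} (hm : m ∈ antiInv ν) {j k : Fin n}
    (h : word ν j = word ν k) (p : ℤ) :
    tensClass (Function.update (word ν) j p) m = tensClass (Function.update (word ν) k p) m := by
  have h2 : Function.update (word ν) j p =
      fun l => Function.update (word ν) k p (Equiv.swap j k l) := by
    funext l
    by_cases hl : l = j
    · subst hl; simp
    · by_cases hl2 : l = k
      · subst hl2
        rw [Equiv.swap_apply_right, Function.update_of_ne hl, Function.update_of_ne (Ne.symm hl), h]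
      · rw [Equiv.swap_apply_of_ne_of_ne hl hl2, Function.update_of_ne hl,
          Function.update_of_ne hl2]
  rw [h2, tensClass_comp, hm _ (swap_mem_young h)]

/-- Lifting f to f ε_ν / |S_ν|, the matrix unit gives ν_q equal terms. The condition `hν` says that
the modified word is already increasing, so no reordering sign appears. -/
theorem coinvRep_matrixUnit (hφ : Function.Bijective (phi n)) {p q : ℤ} {x : glInf}
    (hx : x.1 = matrixUnit p q) {ν ν' : Comp n} {k : Fin n} (hk : word ν k = q)
    (hν : word ν' = Function.update (word ν) k p) (f : inv (young ν)) (g : inv (young ν'))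
    (hg : (g : Coinv n) = ((ν.1 q : ℂ) / (Nat.card (young ν) : ℂ)) •
      ddem (young ν') ((f : Coinv n) * eps (young ν))) :
    coinvRep n hφ x (toSum ν f) = toSum ν' g := by
  have hm := mul_eps_mem_antiInv f.2
  have h1 : toSum ν f = phi n (tensClass (word ν)
      ((1 / (Nat.card (young ν) : ℂ)) • ((f : Coinv n) * eps (young ν)))) := by
    rw [phi_tensClass_word]
    refine congrArg _ (Subtype.ext ?_)
    change (f : Coinv n) = ddem (young ν) _
    rw [map_smul, (parab_young ν).ddem_mul_eps f.2, smul_smul,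
      one_div_mul_cancel (card_ne_zero _), one_smul]
  rw [h1, coinvRep_phi, map_smul, map_smul, tensCoinvRep_tensClass hx,
    Finset.sum_congr rfl (g := fun _ => tensClass (word ν') ((f : Coinv n) * eps (young ν))),
    Finset.sum_const, card_word_eq, map_smul, map_nsmul, phi_tensClass_word, ← map_nsmul,
    ← map_smul]
  · refine congrArg _ (Subtype.ext ?_)
    rw [hg]
    change (1 / (Nat.card (young ν) : ℂ)) • (ν.1 q) •
      ddem (young ν') ((f : Coinv n) * eps (young ν)) = _
    rw [← Nat.cast_smul_eq_nsmul ℂ, smul_smul]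
    congr 1
    ring
  · intro j hj
    rw [hν, tensClass_update_eq hm ((Finset.mem_filter.1 hj).2.trans hk.symm)]

/-! ### Complete and elementary symmetric polynomials -/

/-- Rewrites the sum over multisets as a sum over exponent vectors, the form in which coefficients
of a product of power series appear. -/
theorem hsymm_eq_sum_finsuppAntidiag (σ : Type*) [Fintype σ] [DecidableEq σ] (d : ℕ) :
    hsymm σ ℂ d = ∑ l ∈ Finset.univ.finsuppAntidiag d, ∏ i : σ, (X i : MvPolynomial σ ℂ) ^ l i := by
  rw [hsymm]
  refine Finset.sum_bij' (fun s _ => Multiset.toFinsupp s.1)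
    (fun l hl => ⟨Finsupp.toMultiset l, ?_⟩) ?_ ?_ ?_ ?_ ?_
  · rw [Finsupp.card_toMultiset]
    exact (Finset.mem_finsuppAntidiag'.1 hl).1
  · intro s _
    rw [Finset.mem_finsuppAntidiag']
    refine ⟨?_, Finset.subset_univ _⟩
    change (Multiset.toFinsupp s.1).sum (fun _ => id) = d
    rw [Multiset.toFinsupp_sum_eq]
    exact s.2
  · intro l _; exact Finset.mem_univ _
  · intro s _
    refine Subtype.ext ?_
    simp
  · intro l _
    simp
  · intro s _
    rw [Finset.prod_multiset_map_count]
    refine Finset.prod_subset (Finset.subset_univ _) ?_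
    intro i _ hi
    rw [Multiset.count_eq_zero_of_notMem (by simpa using hi), pow_zero]

/-- The coefficient of T^N in ∏ (1 - x_i T) · ∏ (1 - x_i T)⁻¹ = 1. -/
theorem sum_antidiagonal_esymm_hsymm (σ : Type*) [Fintype σ] [DecidableEq σ] {N : ℕ}
    (hN : N ≠ 0) :
    ∑ s ∈ Finset.range (N + 1), (-1) ^ s * (esymm σ ℂ s * hsymm σ ℂ (N - s)) = 0 := by
  have h1 : ∀ i : σ, (1 + PowerSeries.C (-X i : MvPolynomial σ ℂ) * PowerSeries.X) *
      PowerSeries.mk (fun r => (X i : MvPolynomial σ ℂ) ^ r) = 1 := by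
    intro i
    ext1 r
    cases r with
    | zero => simp [add_mul, mul_assoc]
    | succ r =>
      rw [add_mul, one_mul, map_add, PowerSeries.coeff_mk, mul_assoc, PowerSeries.coeff_C_mul,
        PowerSeries.coeff_succ_X_mul, PowerSeries.coeff_mk, PowerSeries.coeff_one,
        if_neg (Nat.succ_ne_zero r)]
      ring
  have h2 : ∏ i : σ, PowerSeries.mk (fun r => (X i : MvPolynomial σ ℂ) ^ r) =
      PowerSeries.mk (hsymm σ ℂ) := by
    ext1 d
    rw [PowerSeries.coeff_prod, PowerSeries.coeff_mk, hsymm_eq_sum_finsuppAntidiag]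
    simp
  have h3 : ∏ i : σ, (1 + PowerSeries.C (-X i : MvPolynomial σ ℂ) * PowerSeries.X) =
      PowerSeries.mk fun s => (-1) ^ s * esymm σ ℂ s := by
    ext1 d
    rw [Finset.prod_one_add, map_sum, PowerSeries.coeff_mk, esymm, Finset.mul_sum]
    rw [← Finset.sum_subset (s₁ := Finset.univ.powersetCard d)
      (fun t ht => Finset.mem_powerset.2 (Finset.mem_powersetCard.1 ht).1)]
    · refine Finset.sum_congr rfl fun t ht => ?_
      rw [Finset.prod_mul_distrib, Finset.prod_const, (Finset.mem_powersetCard.1 ht).2,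
        ← map_prod, PowerSeries.coeff_C_mul, PowerSeries.coeff_X_pow, if_pos rfl, mul_one,
        Finset.prod_neg, (Finset.mem_powersetCard.1 ht).2]
    · intro t _ ht
      rw [Finset.prod_mul_distrib, Finset.prod_const,
        ← map_prod, PowerSeries.coeff_C_mul, PowerSeries.coeff_X_pow, if_neg, mul_zero]
      rintro rfl
      exact ht (Finset.mem_powersetCard.2 ⟨Finset.subset_univ _, rfl⟩)
  have h4 : (PowerSeries.mk fun s => (-1) ^ s * esymm σ ℂ s) * PowerSeries.mk (hsymm σ ℂ) = 1 := by
    rw [← h2, ← h3, ← Finset.prod_mul_distrib]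
    exact Finset.prod_eq_one fun i _ => h1 i
  have h5 := congrArg (PowerSeries.coeff N) h4
  rw [PowerSeries.coeff_mul, PowerSeries.coeff_one, if_neg hN,
    Finset.Nat.sum_antidiagonal_eq_sum_range_succ_mk] at h5
  simpa [mul_assoc] using h5

/-- The complete symmetric polynomial of degree `r` in the variables `x_l`, `l ∈ Y`. -/
def hsym (Y : Finset (Fin n)) (r : ℕ) : MvPolynomial (Fin n) ℂ :=
  rename Subtype.val (hsymm {j : Fin n // j ∈ Y} ℂ r)

theorem rename_esymm_subtype (Y : Finset (Fin n)) (r : ℕ) :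
    rename Subtype.val (esymm {j : Fin n // j ∈ Y} ℂ r) = esym Y r := by
  have h := aeval_esymm_eq_multiset_esymm {j : Fin n // j ∈ Y} ℂ r
    (fun j => (X j.1 : MvPolynomial (Fin n) ℂ))
  have h2 : (Finset.univ : Finset {j : Fin n // j ∈ Y}).val.map
      (fun j => (X j.1 : MvPolynomial (Fin n) ℂ)) = Y.val.map X :=
    Multiset.attach_map_val' Y.val (X : Fin n → MvPolynomial (Fin n) ℂ)
  rw [h2] at h
  have h3 : (rename Subtype.val : MvPolynomial {j : Fin n // j ∈ Y} ℂ →ₐ[ℂ] _) =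
      aeval fun j => (X j.1 : MvPolynomial (Fin n) ℂ) := algHom_ext fun j => by simp
  rw [h3]
  exact h

theorem esym_eq_zero {Y : Finset (Fin n)} {r : ℕ} (h : Y.card < r) : esym Y r = 0 := by
  rw [esym_eq_sum, Finset.powersetCard_eq_empty.2 h, Finset.sum_empty]

theorem sum_esym_hsym (Y : Finset (Fin n)) {N : ℕ} (hN : N ≠ 0) :
    ∑ s ∈ Finset.range (N + 1), (-1) ^ s * (esym Y s * hsym Y (N - s)) = 0 := by
  have h := congrArg (rename Subtype.val)
    (sum_antidiagonal_esymm_hsymm {j : Fin n // j ∈ Y} hN)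
  simpa [rename_esymm_subtype, hsym] using h

/-- The complete symmetric polynomial of degree `t - b`. -/
def hshift (Y : Finset (Fin n)) (b t : ℕ) : MvPolynomial (Fin n) ℂ :=
  if b ≤ t then hsym Y (t - b) else 0

/-- The recursion that the powers of x_k satisfy for k in Y, now for the h_(t-b). The two ranges of
summation differ only in vanishing terms: h of negative degree for s > t + 1, and e_s = 0 for s > b
+ 1. -/
theorem sum_esym_hshift (Y : Finset (Fin n)) {b : ℕ} (hb : Y.card = b + 1) (t : ℕ) :
    ∑ s ∈ Finset.range (b + 2), (-1) ^ s * (esym Y s * hshift Y b (t + (b + 1 - s))) = 0 := by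
  rw [← sum_esym_hsym Y (Nat.succ_ne_zero t)]
  have e1 : ∑ s ∈ Finset.range (b + 2), (-1) ^ s * (esym Y s * hshift Y b (t + (b + 1 - s))) =
      ∑ s ∈ Finset.range (b + 2) with s ≤ t + 1,
        (-1) ^ s * (esym Y s * hsym Y (t + 1 - s)) := by
    rw [Finset.sum_filter]
    refine Finset.sum_congr rfl fun s hs => ?_
    rw [Finset.mem_range] at hs
    rw [hshift]
    by_cases h : s ≤ t + 1
    · rw [if_pos h, if_pos (by omega)]
      congr 3
      omega
    · rw [if_neg h, if_neg (by omega), mul_zero, mul_zero]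
  rw [e1]
  refine Finset.sum_subset ?_ ?_
  · intro s hs
    simp only [Finset.mem_filter, Finset.mem_range] at hs ⊢
    omega
  · intro s hs hs2
    simp only [Finset.mem_filter, Finset.mem_range] at hs hs2
    rw [esym_eq_zero (by omega), zero_mul, mul_zero]

/-! ### Push-forward along a point stabiliser -/

/-- `K` is the stabiliser in `H` of the point `k`, whose `H`-orbit is `Y`, and `σ` is the sign
relating the two natural orders of the differences `x_k - x_l`. -/
structure PointStab (K H : Subgroup (Equiv.Perm (Fin n))) (k : Fin n) (Y : Finset (Fin n))
    (σ : ℂ) : Prop where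
  parabH : Parab H
  parabK : Parab K
  mem_iff : ∀ w, w ∈ K ↔ w ∈ H ∧ w k = k
  mem_orbit : ∀ l, l ∈ Y ↔ l ∈ MulAction.orbit H k
  sign : σ * σ = 1
  epsPoly_eq : epsPoly H = C σ * (epsPoly K * ∏ l ∈ Y.erase k, (X k - X l))

/-- The push-forward on polynomials. -/
def ppush (K H : Subgroup (Equiv.Perm (Fin n))) :
    MvPolynomial (Fin n) ℂ →ₗ[ℂ] MvPolynomial (Fin n) ℂ :=
  (1 / (Nat.card K : ℂ)) • (dem H ∘ₗ LinearMap.mulLeft ℂ (epsPoly K))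

theorem ppush_apply (K H : Subgroup (Equiv.Perm (Fin n))) (f : MvPolynomial (Fin n) ℂ) :
    ppush K H f = (1 / (Nat.card K : ℂ)) • dem H (epsPoly K * f) := rfl

namespace PointStab

variable {K H : Subgroup (Equiv.Perm (Fin n))} {k : Fin n} {Y : Finset (Fin n)} {σ : ℂ}
  (S : PointStab K H k Y σ)
include S

theorem self_mem : k ∈ Y := (S.mem_orbit k).2 (MulAction.mem_orbit_self k)

theorem le : K ≤ H := fun w hw => ((S.mem_iff w).1 hw).1

theorem apply_mem_iff {w : Equiv.Perm (Fin n)} (hw : w ∈ H) (l : Fin n) : w l ∈ Y ↔ l ∈ Y := by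
  rw [S.mem_orbit, S.mem_orbit]
  rw [mem_orbit_iff, mem_orbit_iff]
  constructor
  · rintro ⟨u, hu, h⟩
    refine ⟨w⁻¹ * u, H.mul_mem (H.inv_mem hw) hu, ?_⟩
    rw [Equiv.Perm.mul_apply, h]
    exact w.symm_apply_apply l
  · rintro ⟨u, hu, rfl⟩
    exact ⟨w * u, H.mul_mem hw hu, rfl⟩

theorem card_eq : Nat.card H = Nat.card K * Y.card := by
  rw [← Nat.card_congr (MulAction.orbitProdStabilizerEquivGroup H k), Nat.card_prod, mul_comm]
  congr 1
  · refine Nat.card_congr ⟨fun w => ⟨w.1.1, (S.mem_iff _).2 ⟨w.1.2, w.2⟩⟩,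
      fun w => ⟨⟨w.1, S.le w.2⟩, ((S.mem_iff _).1 w.2).2⟩, fun _ => rfl, fun _ => rfl⟩
  · exact (Nat.card_congr (Equiv.subtypeEquivRight fun l => (S.mem_orbit l).symm)).trans
      (Nat.card_eq_fintype_card.trans (Fintype.card_coe Y))

theorem ppush_mul {s : MvPolynomial (Fin n) ℂ} (hs : ∀ w ∈ H, rename w s = s)
    (f : MvPolynomial (Fin n) ℂ) : ppush K H (s * f) = s * ppush K H f := by
  rw [ppush_apply, ppush_apply, mul_left_comm, S.parabH.dem_mul hs, mul_smul_comm]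

theorem rename_ppush {w : Equiv.Perm (Fin n)} (hw : w ∈ H) (f : MvPolynomial (Fin n) ℂ) :
    rename w (ppush K H f) = ppush K H f := by
  rw [ppush_apply, map_smul, S.parabH.rename_dem hw]

theorem card_samePairs : (samePairs H).card = (samePairs K).card + (Y.card - 1) := by
  have h : (C σ * (epsPoly K * ∏ l ∈ Y.erase k, (X k - X l))).IsHomogeneous
      ((samePairs K).card + (Y.card - 1)) := by
    refine ((epsPoly_isHomogeneous K).mul ?_).C_mul _
    rw [← Finset.card_erase_of_mem S.self_mem, Finset.card_eq_sum_ones]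
    exact IsHomogeneous.prod _ _ _ fun p _ => (isHomogeneous_X _ _).sub (isHomogeneous_X _ _)
  rw [← S.epsPoly_eq] at h
  exact (epsPoly_isHomogeneous H).inj_right h (epsPoly_ne_zero H)

/-- ε_K x_k^t has smaller degree than ε_H, so its antisymmetrisation, being divisible by ε_H,
vanishes. -/
theorem ppush_X_pow_of_lt {t : ℕ} (ht : t + 1 < Y.card) : ppush K H (X k ^ t) = 0 := by
  rw [ppush_apply, S.parabH.dem_eq_zero_of_lt ((epsPoly_isHomogeneous K).mul
    (isHomogeneous_X_pow k t)), smul_zero]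
  rw [S.card_samePairs]
  omega

/-- The derivative of ∏ (T - x_l), l in Y, at T = x_k. Unlike a direct expansion of the product, it
has coefficients e_s(Y), which are `H`-invariant. -/
theorem prod_erase_eq : ∏ l ∈ Y.erase k, (X k - X l : MvPolynomial (Fin n) ℂ) =
    ∑ s ∈ Finset.range (Y.card + 1),
      (-1) ^ s * (esym Y s * (((Y.card - s : ℕ) : MvPolynomial (Fin n) ℂ) *
        X k ^ (Y.card - s - 1))) := by
  have h := Multiset.prod_X_sub_X_eq_sum_esymm
    (Y.val.map (X : Fin n → MvPolynomial (Fin n) ℂ))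
  rw [Multiset.map_map, Multiset.card_map] at h
  have h3 : ∀ s, ((-1) ^ s : Polynomial (MvPolynomial (Fin n) ℂ)) = Polynomial.C ((-1) ^ s) := by
    simp
  simp only [h3] at h
  have h1 : (Y.val.map ((fun t => Polynomial.X - Polynomial.C t) ∘
      (X : Fin n → MvPolynomial (Fin n) ℂ))).prod = (Polynomial.X - Polynomial.C (X k)) *
        ∏ l ∈ Y.erase k, (Polynomial.X - Polynomial.C (X l)) := by
    rw [Finset.mul_prod_erase Y
      (fun l => Polynomial.X - Polynomial.C (X l : MvPolynomial (Fin n) ℂ)) S.self_mem]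
    rfl
  rw [h1] at h
  have h2 := congrArg (fun p => Polynomial.eval (X k) (Polynomial.derivative p)) h
  simp only [Polynomial.derivative_mul, Polynomial.eval_add, Polynomial.eval_mul,
    Polynomial.derivative_sub, Polynomial.derivative_X, Polynomial.derivative_C, sub_zero,
    one_mul, Polynomial.eval_sub, Polynomial.eval_X, Polynomial.eval_C,
    sub_self, zero_mul, add_zero, Polynomial.eval_prod, Polynomial.derivative_sum,
    Polynomial.eval_finsetSum] at h2
  rw [h2]
  refine Finset.sum_congr rfl fun s _ => ?_
  simp [esym, Polynomial.derivative_X_pow]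

/-- The push-forward of σ ∏ (x_k - x_l) is |H| / |K| = |Y|, since multiplication by ε_K turns this
product into ε_H. In the expansion of the product by `prod_erase_eq` only s = 0 survives for degree
reasons, with coefficient |Y|. -/
theorem ppush_X_pow_card : ppush K H (X k ^ (Y.card - 1)) = C σ := by
  have hpos : 0 < Y.card := Finset.card_pos.2 ⟨k, S.self_mem⟩
  have h1 : ppush K H (C σ * ∏ l ∈ Y.erase k, (X k - X l)) = C (Y.card : ℂ) := by
    rw [ppush_apply, mul_left_comm, ← S.epsPoly_eq, S.parabH.dem_epsPoly, S.card_eq,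
      smul_eq_C_mul, ← map_mul, Nat.cast_mul, ← mul_assoc, one_div_mul_cancel (card_ne_zero K),
      one_mul]
  rw [S.prod_erase_eq, ← smul_eq_C_mul, map_smul, map_sum, Finset.sum_range_succ',
    Finset.sum_eq_zero, zero_add] at h1
  · simp only [pow_zero, esym_zero, one_mul, Nat.sub_zero] at h1
    rw [← map_natCast C, ← smul_eq_C_mul, map_smul, smul_smul, mul_comm, ← smul_smul] at h1
    have hc : (Y.card : ℂ) ≠ 0 := Nat.cast_ne_zero.2 hpos.ne'
    have h2 : σ • ppush K H (X k ^ (Y.card - 1)) = 1 := by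
      have h3 := congrArg (fun z => (Y.card : ℂ)⁻¹ • z) h1
      simp only [smul_smul, inv_mul_cancel_left₀ hc] at h3
      rw [h3, smul_eq_C_mul, ← map_mul, inv_mul_cancel₀ hc, map_one]
    have h4 := congrArg (fun z => σ • z) h2
    simp only [smul_smul, S.sign, one_smul] at h4
    rw [h4, smul_eq_C_mul, mul_one]
  · intro s hs
    have he : ∀ w ∈ H, rename w ((-1) ^ (s + 1) * esym Y (s + 1)) =
        ((-1) ^ (s + 1) * esym Y (s + 1)) := by
      intro w hw
      rw [map_mul, rename_esym (S.apply_mem_iff hw)]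
      simp
    rw [← mul_assoc, S.ppush_mul he, ← map_natCast C, ← smul_eq_C_mul, map_smul]
    rcases Nat.lt_or_ge (s + 1) Y.card with h | h
    · rw [S.ppush_X_pow_of_lt (by omega), smul_zero, mul_zero]
    · rw [Nat.sub_eq_zero_of_le h, Nat.cast_zero, zero_smul, mul_zero]

theorem ppush_X_pow {b : ℕ} (hb : Y.card = b + 1) (t : ℕ) :
    ppush K H (X k ^ t) = C σ * hshift Y b t := by
  induction t using Nat.strong_induction_on with
  | _ t ih =>
    rcases lt_trichotomy t b with h | h | h
    · rw [S.ppush_X_pow_of_lt (by omega), hshift, if_neg (by omega), mul_zero]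
    · have := S.ppush_X_pow_card
      rw [hb, Nat.add_sub_cancel] at this
      rw [h, this, hshift, if_pos le_rfl, Nat.sub_self, hsym, hsymm_zero, map_one, mul_one]
    -- Beyond t = b both sides satisfy the recursion with coefficients (-1)^s e_s(Y); the term s = 0
    -- is the one sought, and the others are known by induction.
    · obtain ⟨u, rfl⟩ : ∃ u, t = u + (b + 1) := ⟨t - (b + 1), by omega⟩
      have hz := prod_sub_X_eq_sum_esym Y (X k : MvPolynomial (Fin n) ℂ)
      rw [Finset.prod_eq_zero S.self_mem (sub_self _), hb] at hz
      have hz2 := congrArg (fun f => ppush K H (X k ^ u * f)) hz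
      simp only [mul_zero, map_zero, Finset.mul_sum, map_sum] at hz2
      have hz3 : ∀ s, ppush K H (X k ^ u * ((-1) ^ s * (esym Y s * X k ^ (b + 1 - s)))) =
          (-1) ^ s * (esym Y s * ppush K H (X k ^ (u + (b + 1 - s)))) := by
        intro s
        have he : ∀ w ∈ H, rename w ((-1) ^ s * esym Y s) = ((-1) ^ s * esym Y s) := by
          intro w hw
          rw [map_mul, rename_esym (S.apply_mem_iff hw)]
          simp
        rw [← mul_assoc _ (esym Y s) (ppush K H _), ← S.ppush_mul he, pow_add]
        congr 1
        ring
      simp only [hz3] at hz2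
      replace hz2 := hz2.symm
      have hr := congrArg (fun f => C σ * f) (sum_esym_hshift Y hb u)
      simp only [mul_zero, Finset.mul_sum] at hr
      have hz4 := hz2.trans hr.symm
      rw [Finset.sum_range_succ', Finset.sum_range_succ' _ (b + 1)] at hz4
      rw [Finset.sum_congr rfl (g := fun s => C σ * ((-1) ^ (s + 1) *
        (esym Y (s + 1) * hshift Y b (u + (b + 1 - (s + 1))))))] at hz4
      · have := add_left_cancel hz4
        simpa [esym_zero] using this
      · intro s hs
        rw [ih _ (by rw [Finset.mem_range] at hs; omega)]
        ring

/-- Invariants of `K` are polynomials in `x_k` with coefficients in the invariants of `H`. -/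
theorem exists_eq_sum {z : MvPolynomial (Fin n) ℂ} (hz : ∀ w ∈ K, rename w z = z) :
    ∃ (N : ℕ) (c : ℕ → MvPolynomial (Fin n) ℂ), (∀ s, ∀ w ∈ H, rename w (c s) = c s) ∧
      z = ∑ s ∈ Finset.range N, c s * X k ^ s := by
  classical
  -- Interpolation: in the sum over w in `H` of sgn(w) w(ε_K z) (wQ)(x_k), only w in `K` contribute,
  -- and together they give |K| σ ε_H z. Expanding Q in powers of T instead gives ε_H times a
  -- polynomial in x_k with `H`-invariant coefficients.
  set Q : Polynomial (MvPolynomial (Fin n) ℂ) :=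
    ∏ l ∈ Y.erase k, (Polynomial.X - Polynomial.C (X l)) with hQ
  set N := Q.natDegree + 1 with hN
  refine ⟨N, fun s => σ • ppush K H (z * Q.coeff s), fun s w hw => ?_, ?_⟩
  · rw [map_smul, S.rename_ppush hw]
  have hev : ∀ w : Equiv.Perm (Fin n), ∏ l ∈ Y.erase k, (X k - X (w l)) =
      ∑ s ∈ Finset.range N, rename w (Q.coeff s) * (X k : MvPolynomial (Fin n) ℂ) ^ s := by
    intro w
    have h := Polynomial.eval₂_eq_sum_range (p := Q)
      ((rename w : MvPolynomial (Fin n) ℂ →ₐ[ℂ] MvPolynomial (Fin n) ℂ).toRingHom) (X k)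
    have h' : Polynomial.eval₂ ((rename w : MvPolynomial (Fin n) ℂ →ₐ[ℂ]
        MvPolynomial (Fin n) ℂ).toRingHom) (X k) Q = ∏ l ∈ Y.erase k, (X k - X (w l)) := by
      rw [hQ, Polynomial.eval₂_finsetProd]
      simp
    exact h'.symm.trans h
  have hK : ∀ w ∈ K, ∏ l ∈ Y.erase k, (X k - X (w l) : MvPolynomial (Fin n) ℂ) =
      ∏ l ∈ Y.erase k, (X k - X l) := by
    intro w hw
    have h1 := S.parabH.rename_epsPoly (S.le hw)
    rw [S.epsPoly_eq, map_mul, map_mul, S.parabK.rename_epsPoly hw, map_prod, smul_mul_assoc,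
      mul_smul_comm, rename_C] at h1
    have h2 := congrArg (fun z => sgn w • z) h1
    simp only [smul_smul, sgn_mul_self, one_smul, map_sub, rename_X, ((S.mem_iff w).1 hw).2] at h2
    have hσ : (C σ : MvPolynomial (Fin n) ℂ) ≠ 0 := by
      rw [Ne, map_eq_zero_iff _ (C_injective _ _)]
      rintro rfl
      simpa using S.sign
    exact mul_left_cancel₀ (epsPoly_ne_zero K) (mul_left_cancel₀ hσ h2)
  have hterm : ∀ w : Equiv.Perm (Fin n), w ∈ H →
      (sgn w • rename w (epsPoly K * z)) * ∏ l ∈ Y.erase k, (X k - X (w l)) =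
        if w ∈ K then C σ * (epsPoly H * z) else 0 := by
    intro w hw
    split_ifs with h
    · rw [hK w h, map_mul, S.parabK.rename_epsPoly h, hz w h, S.epsPoly_eq,
        smul_mul_assoc (sgn w) (epsPoly K), smul_mul_assoc, smul_mul_assoc, smul_smul,
        sgn_mul_self, one_smul]
      have : (C σ * C σ : MvPolynomial (Fin n) ℂ) = 1 := by rw [← map_mul, S.sign, map_one]
      linear_combination (-(epsPoly K * z * ∏ l ∈ Y.erase k, (X k - X l))) * this
    -- If w moves k, the factor with index w⁻¹ k is x_k - x_k.
    · have hne : w⁻¹ k ≠ k := by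
        intro h2
        refine h ((S.mem_iff w).2 ⟨hw, ?_⟩)
        conv_lhs => rw [← h2]
        exact w.apply_symm_apply k
      have hY : w⁻¹ k ∈ Y.erase k := Finset.mem_erase.2
        ⟨hne, (S.apply_mem_iff (H.inv_mem hw) k).2 S.self_mem⟩
      rw [Finset.prod_eq_zero hY, mul_zero]
      rw [show w (w⁻¹ k) = k from w.apply_symm_apply k, sub_self]
  have hsum1 : ∑ w : Equiv.Perm (Fin n) with w ∈ H,
      (sgn w • rename w (epsPoly K * z)) * ∏ l ∈ Y.erase k, (X k - X (w l)) =
        (Nat.card K : ℂ) • (C σ * (epsPoly H * z)) := by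
    rw [Finset.sum_congr rfl fun w hw => hterm w (Finset.mem_filter.1 hw).2, ← Finset.sum_filter,
      Finset.filter_filter, Finset.sum_const, Nat.cast_smul_eq_nsmul, ← card_filter_mem K]
    congr 2
    ext w
    simp only [Finset.mem_filter, Finset.mem_univ, true_and]
    exact ⟨fun h => h.2, fun h => ⟨S.le h, h⟩⟩
  have hsum2 : ∑ w : Equiv.Perm (Fin n) with w ∈ H,
      (sgn w • rename w (epsPoly K * z)) * ∏ l ∈ Y.erase k, (X k - X (w l)) =
        epsPoly H * ∑ s ∈ Finset.range N, dem H (epsPoly K * (z * Q.coeff s)) * X k ^ s := by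
    rw [Finset.mul_sum]
    simp_rw [← mul_assoc, S.parabH.epsPoly_mul_dem, antisym_apply, Finset.sum_mul]
    rw [Finset.sum_comm]
    refine Finset.sum_congr rfl fun w _ => ?_
    rw [hev, Finset.mul_sum]
    refine Finset.sum_congr rfl fun s _ => ?_
    simp only [map_mul, smul_mul_assoc]
    congr 1
    ring
  have hfin := hsum1.symm.trans hsum2
  have hfin2 : (Nat.card K : ℂ) • (C σ * z) =
      ∑ s ∈ Finset.range N, dem H (epsPoly K * (z * Q.coeff s)) * X k ^ s := by
    refine mul_left_cancel₀ (epsPoly_ne_zero H) ?_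
    rw [← hfin, mul_smul_comm]
    congr 1
    ring
  have hfin3 := congrArg (fun f => (σ * (1 / (Nat.card K : ℂ))) • f) hfin2
  simp only [smul_smul, mul_assoc σ, one_div_mul_cancel (card_ne_zero K), mul_one] at hfin3
  rw [← smul_eq_C_mul, smul_smul, S.sign, one_smul, Finset.smul_sum] at hfin3
  refine hfin3.trans (Finset.sum_congr rfl fun s _ => ?_)
  change _ = σ • ppush K H (z * Q.coeff s) * X k ^ s
  rw [ppush_apply, smul_smul, smul_mul_assoc]

end PointStab

/-- A quotient of two `K`-alternating products is `K`-invariant; this is why multiplication by the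
products in the theorem makes sense in the invariants of S_ν ∩ S_ν'. -/
theorem rename_eq_of_epsPoly_eq {K H : Subgroup (Equiv.Perm (Fin n))} (hK : Parab K)
    (hH : Parab H) (h : K ≤ H) {δ : MvPolynomial (Fin n) ℂ} (hδ : epsPoly H = epsPoly K * δ)
    {w : Equiv.Perm (Fin n)} (hw : w ∈ K) : rename w δ = δ := by
  have h1 := hH.rename_epsPoly (h hw)
  rw [hδ, map_mul, hK.rename_epsPoly hw, smul_mul_assoc] at h1
  have h2 := congrArg (fun z => sgn w • z) h1
  simp only [smul_smul, sgn_mul_self, one_smul] at h2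
  exact mul_left_cancel₀ (epsPoly_ne_zero K) h2

/-! ### Module homomorphisms -/

namespace PointStab

variable {K H : Subgroup (Equiv.Perm (Fin n))} {k : Fin n} {Y : Finset (Fin n)} {σ : ℂ}
  (S : PointStab K H k Y σ)
include S

theorem coe_pushforward_toCoinv (h : K ≤ H) {z : inv K} {f : MvPolynomial (Fin n) ℂ}
    (hz : (z : Coinv n) = toCoinv n f) :
    (pushforward h z : Coinv n) = toCoinv n (ppush K H f) := by
  rw [S.parabH.coe_pushforward S.parabK, hz, eps, ← map_mul, S.parabH.ddem_toCoinv, ppush_apply,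
    map_smul, mul_comm]

theorem pushforward_mul (h : K ≤ H) (z : inv H) (y : inv K) :
    pushforward h (pullback h z * y) = z * pushforward h y := by
  refine Subtype.ext ?_
  change _ = (z : Coinv n) * (pushforward h y : Coinv n)
  rw [S.parabH.coe_pushforward S.parabK, S.parabH.coe_pushforward S.parabK, mul_smul_comm,
    ← S.parabH.ddem_mul z.2, ← mul_assoc]
  rfl

/-- The push-forward obeys the projection formula, which gives linearity; uniqueness holds because
`exists_eq_sum` writes every element of C^K as a combination of powers of x_k over C^H. -/
theorem isUniqueModuleHom (h : K ≤ H) {x : inv K} (hx : (x : Coinv n) = toCoinv n (X k))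
    {y : inv K} {f : MvPolynomial (Fin n) ℂ} (hy : (y : Coinv n) = toCoinv n f)
    {c : ℕ → Coinv n} (hc : ∀ r, toCoinv n (ppush K H (f * X k ^ r)) = c r) :
    IsUniqueModuleHom h x c (pushforward h ∘ₗ LinearMap.mulLeft ℂ y) := by
  have h1 : ∀ (z : inv H) (u : inv K), (pushforward h ∘ₗ LinearMap.mulLeft ℂ y)
      (pullback h z * u) = z * (pushforward h ∘ₗ LinearMap.mulLeft ℂ y) u := by
    intro z u
    change pushforward h (y * (pullback h z * u)) = z * pushforward h (y * u)
    rw [mul_left_comm, S.pushforward_mul]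
  have h2 : ∀ r, ((pushforward h ∘ₗ LinearMap.mulLeft ℂ y) (x ^ r) : Coinv n) = c r := by
    intro r
    rw [← hc r]
    refine S.coe_pushforward_toCoinv h ?_
    change (y : Coinv n) * (x : Coinv n) ^ r = _
    rw [hy, hx, map_mul, map_pow]
  intro g'
  constructor
  · rintro ⟨h3, h4⟩
    refine LinearMap.ext fun z => ?_
    obtain ⟨p, hp, hpz⟩ := exists_invariant_lift z.2
    obtain ⟨N, q, hq, hpq⟩ := S.exists_eq_sum hp
    have hz : z = ∑ s ∈ Finset.range N,
        pullback h (⟨_, toCoinv_mem_inv (hq s)⟩ : inv H) * x ^ s := by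
      refine Subtype.ext ?_
      rw [AddSubmonoidClass.coe_finsetSum, ← hpz, hpq, map_sum]
      refine Finset.sum_congr rfl fun s _ => ?_
      change _ = toCoinv n (q s) * (x : Coinv n) ^ s
      rw [hx, map_mul, map_pow]
    rw [hz, map_sum, map_sum]
    refine Finset.sum_congr rfl fun s _ => ?_
    rw [h3, h1]
    congr 1
    exact Subtype.ext ((h4 s).trans (h2 s).symm)
  · rintro rfl
    exact ⟨h1, h2⟩

/-- As Z is stable under `H`, the coefficients e_s(Z) of the product in powers of x_k leave the
push-forward. -/
theorem ppush_prod_mul {b : ℕ} (hb : Y.card = b + 1) {Z : Finset (Fin n)}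
    (hZ : ∀ w ∈ H, ∀ l, w l ∈ Z ↔ l ∈ Z) (r : ℕ) :
    ppush K H ((∏ l ∈ Z, (X k - X l)) * X k ^ r) =
      C σ * ∑ s ∈ Finset.range (Z.card + 1),
        (-1) ^ s * esym Z s * hshift Y b (Z.card - s + r) := by
  rw [prod_sub_X_eq_sum_esym, Finset.sum_mul, map_sum, Finset.mul_sum]
  refine Finset.sum_congr rfl fun s _ => ?_
  have he : ∀ w ∈ H, rename w ((-1) ^ s * esym Z s) = (-1) ^ s * esym Z s := by
    intro w hw
    rw [map_mul, rename_esym (hZ w hw)]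
    simp
  rw [← mul_assoc, mul_assoc, ← pow_add, S.ppush_mul he, S.ppush_X_pow hb]
  ring

end PointStab

/-! ### Translation to the symmetric polynomials of a block. -/

theorem elem_eq (ν : Comp n) (i : ℤ) (r : ℕ) : elem ν i r = toCoinv n (esym (block ν i) r) := by
  rw [elem, rename_esymm_subtype]

theorem compl_eq (ν : Comp n) (i : ℤ) {b t : ℕ} {r : ℤ} (hr : r = t - b) :
    compl ν i r = toCoinv n (hshift (block ν i) b t) := by
  rw [compl, hshift]
  by_cases h : b ≤ t
  · rw [if_pos (by omega), if_pos h, hsym, show r.toNat = t - b by omega]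
  · rw [if_neg (by omega), if_neg h, map_zero]

theorem card_block (ν : Comp n) (i : ℤ) : (block ν i).card = ν.1 i := card_word_eq ν i

theorem mem_block {ν : Comp n} {i : ℤ} {l : Fin n} : l ∈ block ν i ↔ word ν l = i := by
  simp [block]

theorem PointStab.toCoinv_ppush {K : Subgroup (Equiv.Perm (Fin n))} {ν : Comp n} {k : Fin n}
    {p q : ℤ} {σ : ℂ} (S : PointStab K (young ν) k (block ν q) σ) {a b : ℕ} (ha : ν.1 p = a)
    (hb : ν.1 q = b + 1) (r : ℕ) :
    toCoinv n (ppush K (young ν) ((∏ l ∈ block ν p, (X k - X l)) * X k ^ r)) =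
      algebraMap ℂ _ σ * ∑ s ∈ Finset.range (a + 1), (-1) ^ s * elem ν p s *
        compl ν q ((r : ℤ) - s + a - b) := by
  have hinv : ∀ w ∈ young ν, ∀ l, w l ∈ block ν p ↔ l ∈ block ν p := by
    intro w hw l
    rw [mem_block, mem_block, hw]
  rw [S.ppush_prod_mul ((card_block ν q).trans hb) hinv, map_mul, map_sum, card_block, ha]
  congr 1
  refine Finset.sum_congr rfl fun s hs => ?_
  rw [Finset.mem_range] at hs
  rw [map_mul, map_mul, ← elem_eq, ← compl_eq ν q (r := (r : ℤ) - s + a - b) (by omega)]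
  simp

/-! ### Adjacent compositions -/

/-- Written with the removed letter added on the left, which avoids truncated subtraction. -/
theorem typ_update (c : Fin n → ℤ) (k : Fin n) (p : ℤ) :
    (typ (Function.update c k p)).1 + Finsupp.single (c k) 1 =
      (typ c).1 + Finsupp.single p 1 := by
  change (∑ j, Finsupp.single (Function.update c k p j) 1) + _ =
    (∑ j, Finsupp.single (c j) 1) + _
  rw [← Finset.add_sum_erase _ _ (Finset.mem_univ k),
    ← Finset.add_sum_erase _ (fun j => Finsupp.single (c j) 1) (Finset.mem_univ k),
    Function.update_self,
    Finset.sum_congr rfl (g := fun j => (Finsupp.single (c j) 1 : ℤ →₀ ℕ))]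
  · abel
  · intro j hj
    rw [Function.update_of_ne (Finset.ne_of_mem_erase hj)]

theorem partialSum_sub_one (ν : Comp n) (i : ℤ) :
    partialSum ν i = partialSum ν (i - 1) + ν.1 i := by
  rw [← card_word_le, ← card_word_le, ← card_word_eq ν i, ← Finset.card_union_of_disjoint]
  · congr 1
    ext l
    simp only [Finset.mem_union, Finset.mem_filter, Finset.mem_univ, true_and]
    omega
  · rw [Finset.disjoint_left]
    intro l hl hl'
    simp only [Finset.mem_filter, Finset.mem_univ, true_and] at hl hl'
    omega

/-- Positions are counted from 0, so `hk` places k just before the first position of the block of i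
+ 1. -/
theorem mem_block_right {i : ℤ} {ν : Comp n} {k : Fin n} (hk : (k : ℕ) + 1 = partialSum ν i)
    (l : Fin n) :
    l ∈ block ν (i + 1) ↔ k < l ∧ (l : ℕ) ≤ k + ν.1 (i + 1) := by
  rw [mem_block_iff]
  have := partialSum_sub_one ν (i + 1)
  rw [add_sub_cancel_right] at this ⊢
  rw [Fin.lt_def]
  omega

section KeySituation

variable {i : ℤ} {ν ν' : Comp n} (h : KeySituation i ν ν') {k : Fin n}
  (hk : (k : ℕ) + 1 = partialSum ν i)
include h hk

theorem mem_block_left (l : Fin n) :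
    l ∈ block ν i ↔ l ≤ k ∧ (k : ℕ) ≤ l + ν'.1 i := by
  rw [mem_block_iff]
  have := partialSum_sub_one ν i
  have := h.1
  rw [Fin.le_def]
  omega

theorem word_apply_left : word ν k = i :=
  mem_block.1 ((mem_block_left h hk k).2 ⟨le_rfl, by omega⟩)

/-- Position k is the last one with letter i, so raising its letter to i + 1 keeps the word
increasing. -/
theorem word_eq_update : word ν' = Function.update (word ν) k (i + 1) := by
  have hw := word_apply_left h hk
  symm
  refine eq_word_of_monotone ?_ ?_
  · intro l m hlm
    have h1 := word_le_iff ν i l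
    have h2 := word_le_iff ν i m
    rw [← hk] at h1 h2
    have hlm' : (l : ℕ) ≤ m := hlm
    by_cases hl : l = k
    · subst hl
      rw [Function.update_self]
      by_cases hm : m = l
      · subst hm
        rw [Function.update_self]
      · have : (m : ℕ) ≠ l := fun h => hm (Fin.ext h)
        rw [Function.update_of_ne hm]
        omega
    · have hne : (l : ℕ) ≠ k := fun h => hl (Fin.ext h)
      rw [Function.update_of_ne hl]
      by_cases hm : m = k
      · subst hm
        rw [Function.update_self]
        omega
      · rw [Function.update_of_ne hm]
        exact word_monotone ν hlm
  · refine Subtype.ext (Finsupp.ext fun j => ?_)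
    have h1 := DFunLike.congr_fun (typ_update (word ν) k (i + 1)) j
    rw [typ_word, hw, Finsupp.add_apply, Finsupp.add_apply, Finsupp.single_apply,
      Finsupp.single_apply] at h1
    obtain ⟨h2, h3, h4⟩ := h
    by_cases hj : j = i
    · subst hj
      rw [if_pos rfl, if_neg (by omega)] at h1
      omega
    · by_cases hj' : j = i + 1
      · subst hj'
        rw [if_pos rfl, if_neg (by omega)] at h1
        omega
      · rw [if_neg (by omega), if_neg (by omega)] at h1
        rw [h4 j hj hj']
        omega

theorem word_apply_right : word ν' k = i + 1 := by
  rw [word_eq_update h hk, Function.update_self]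

theorem word_apply_of_ne {l : Fin n} (hl : l ≠ k) : word ν' l = word ν l := by
  rw [word_eq_update h hk, Function.update_of_ne hl]

theorem word_eq_update' : word ν = Function.update (word ν') k i := by
  funext l
  by_cases hl : l = k
  · subst hl
    rw [Function.update_self, word_apply_left h hk]
  · rw [Function.update_of_ne hl, word_apply_of_ne h hk hl]

theorem block_left_erase : (block ν i).erase k = block ν' i := by
  ext l
  rw [Finset.mem_erase, mem_block, mem_block]
  by_cases hl : l = k
  · subst hl
    rw [word_apply_right h hk]
    simp
  · simp [word_apply_of_ne h hk hl, hl]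

theorem block_right_erase : (block ν' (i + 1)).erase k = block ν (i + 1) := by
  ext l
  rw [Finset.mem_erase, mem_block, mem_block]
  by_cases hl : l = k
  · subst hl
    rw [word_apply_left h hk]
    simp
  · simp [word_apply_of_ne h hk hl, hl]

/-- The two words differ only at k; if w preserved both and moved k, the letter at w k would have to
be both i and i + 1. -/
theorem mem_inf_iff_left (w : Equiv.Perm (Fin n)) :
    w ∈ young ν ⊓ young ν' ↔ w ∈ young ν ∧ w k = k := by
  constructor
  · rintro ⟨h1, h2⟩
    refine ⟨h1, ?_⟩
    by_contra hne
    have h3 := h1 k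
    have h4 := h2 k
    rw [word_apply_of_ne h hk hne, h3, word_apply_left h hk, word_apply_right h hk] at h4
    omega
  · rintro ⟨h1, h2⟩
    refine ⟨h1, fun j => ?_⟩
    by_cases hj : j = k
    · rw [hj, h2]
    · rw [word_apply_of_ne h hk hj, word_apply_of_ne h hk, h1 j]
      exact fun h3 => hj (w.injective (h3.trans h2.symm))

theorem mem_inf_iff_right (w : Equiv.Perm (Fin n)) :
    w ∈ young ν ⊓ young ν' ↔ w ∈ young ν' ∧ w k = k := by
  rw [mem_inf_iff_left h hk]
  refine and_congr_left fun h2 => forall_congr' fun j => ?_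
  by_cases hj : j = k
  · rw [hj, h2]
    simp
  · rw [word_apply_of_ne h hk hj, word_apply_of_ne h hk]
    exact fun h3 => hj (w.injective (h3.trans h2.symm))

theorem orbit_inf_left {l m : Fin n} : l ∈ MulAction.orbit ↑(young ν ⊓ young ν') m ↔
    l = m ∨ (l ≠ k ∧ m ≠ k ∧ word ν l = word ν m) := by
  rw [orbit_young_inf]
  have e1 := word_apply_left h hk
  have e2 := word_apply_right h hk
  by_cases hl : l = k <;> by_cases hm : m = k
  · simp [hl, hm]
  · have e3 := word_apply_of_ne h hk hm
    have : k ≠ m := fun h => hm h.symm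
    subst hl
    simp only [this, ne_eq, not_true_eq_false, false_and, or_self, iff_false, e1, e2, e3]
    omega
  · have e3 := word_apply_of_ne h hk hl
    subst hm
    simp only [hl, ne_eq, not_true_eq_false, false_and, and_false, or_self, iff_false, e1, e2, e3]
    omega
  · rw [word_apply_of_ne h hk hl, word_apply_of_ne h hk hm]
    simp only [and_self, hl, hm, ne_eq, not_false_eq_true, true_and]
    constructor
    · exact Or.inr
    · rintro (rfl | h) <;> first | rfl | assumption

/-- In its block for ν the position k is last, so the additional pairs are (l, k) and the factors
are x_l - x_k. -/
theorem epsPoly_left : epsPoly (young ν) =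
    epsPoly (young ν ⊓ young ν') * ∏ l ∈ block ν' i, (X l - X k) := by
  classical
  have hs : samePairs (young ν) =
      samePairs (young ν ⊓ young ν') ∪ (block ν' i).image fun l => (l, k) := by
    ext ⟨l, m⟩
    rw [Finset.mem_union, mem_samePairs, mem_samePairs, orbit_inf_left h hk, orbit_young,
      Finset.mem_image]
    simp only [← block_left_erase h hk, Finset.mem_erase, mem_block_left h hk, Prod.mk.injEq]
    have e1 := word_apply_left h hk
    have e2 := mem_block_left h hk l
    have e3 := mem_block_left h hk m
    rw [mem_block] at e2 e3
    constructor
    · rintro ⟨h1, h2⟩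
      by_cases hm : m = k
      · refine Or.inr ⟨l, ⟨?_, ?_⟩, rfl, hm.symm⟩
        · exact hm ▸ h1.ne
        · rw [← e2, h2, hm, e1]
      · refine Or.inl ⟨h1, Or.inr ⟨?_, hm, h2⟩⟩
        rintro rfl
        exact absurd (e3.1 (h2.symm.trans e1)).1 (not_le.2 h1)
    · rintro (⟨h1, h2⟩ | ⟨l', ⟨h1, h2⟩, rfl, rfl⟩)
      · exact ⟨h1, (h2.resolve_left h1.ne).2.2⟩
      · exact ⟨lt_of_le_of_ne h2.1 h1, by rw [e1, e2.2 h2]⟩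
  rw [epsPoly, hs, Finset.prod_union, epsPoly, Finset.prod_image]
  · intro l _ m _ hlm
    exact (Prod.mk.inj hlm).1
  · rw [Finset.disjoint_left]
    rintro ⟨l, m⟩ h1 h2
    obtain ⟨l', _, h3⟩ := Finset.mem_image.1 h2
    obtain ⟨rfl, rfl⟩ := Prod.mk.inj h3
    rw [mem_samePairs, orbit_inf_left h hk] at h1
    exact (h1.2.resolve_left h1.1.ne).2.1 rfl

/-- In its block for ν' the position k is first, so the additional pairs are (k, l) and the factors
are x_k - x_l. -/
theorem epsPoly_right : epsPoly (young ν') =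
    epsPoly (young ν ⊓ young ν') * ∏ l ∈ block ν (i + 1), (X k - X l) := by
  classical
  have hs : samePairs (young ν') =
      samePairs (young ν ⊓ young ν') ∪ (block ν (i + 1)).image fun l => (k, l) := by
    ext ⟨l, m⟩
    rw [Finset.mem_union, mem_samePairs, mem_samePairs, orbit_inf_left h hk, orbit_young,
      Finset.mem_image]
    simp only [mem_block_right hk, Prod.mk.injEq]
    have e1 := word_apply_right h hk
    have e2 := mem_block_right hk l
    have e3 := mem_block_right hk m
    rw [mem_block] at e2 e3
    constructor
    · rintro ⟨h1, h2⟩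
      by_cases hl : l = k
      · subst hl
        refine Or.inr ⟨m, ?_, rfl, rfl⟩
        rw [← e3, ← word_apply_of_ne h hk h1.ne', ← h2, e1]
      · by_cases hm : m = k
        · subst hm
          rw [e1, word_apply_of_ne h hk hl] at h2
          exact absurd (e2.1 h2).1 (not_lt.2 h1.le)
        · rw [word_apply_of_ne h hk hl, word_apply_of_ne h hk hm] at h2
          exact Or.inl ⟨h1, Or.inr ⟨hl, hm, h2⟩⟩
    · rintro (⟨h1, h2⟩ | ⟨m', h2, rfl, rfl⟩)
      · obtain ⟨h3, h4, h5⟩ := h2.resolve_left h1.ne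
        rw [word_apply_of_ne h hk h3, word_apply_of_ne h hk h4]
        exact ⟨h1, h5⟩
      · refine ⟨h2.1, ?_⟩
        rw [e1, word_apply_of_ne h hk h2.1.ne', e3.2 h2]
  rw [epsPoly, hs, Finset.prod_union, epsPoly, Finset.prod_image]
  · intro l _ m _ hlm
    exact (Prod.mk.inj hlm).2
  · rw [Finset.disjoint_left]
    rintro ⟨l, m⟩ h1 h2
    obtain ⟨l', _, h3⟩ := Finset.mem_image.1 h2
    obtain ⟨rfl, rfl⟩ := Prod.mk.inj h3
    rw [mem_samePairs, orbit_inf_left h hk] at h1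
    exact (h1.2.resolve_left h1.1.ne).1 rfl

/-- The sign comes from reversing the ν'_i factors x_l - x_k; on the other side, in
`pointStab_right`, no factor is reversed. -/
theorem pointStab_left :
    PointStab (young ν ⊓ young ν') (young ν) k (block ν i) ((-1) ^ ν'.1 i) where
  parabH := parab_young ν
  parabK := parab_young_inf ν ν'
  mem_iff := mem_inf_iff_left h hk
  mem_orbit l := by rw [mem_block, orbit_young, word_apply_left h hk]
  sign := by rw [← mul_pow]; simp
  epsPoly_eq := by
    rw [epsPoly_left h hk, block_left_erase h hk, mul_left_comm]
    congr 1
    rw [map_pow, map_neg, map_one, ← card_block ν' i, ← Finset.prod_neg]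
    simp

theorem pointStab_right :
    PointStab (young ν ⊓ young ν') (young ν') k (block ν' (i + 1)) 1 where
  parabH := parab_young ν'
  parabK := parab_young_inf ν ν'
  mem_iff := mem_inf_iff_right h hk
  mem_orbit l := by rw [mem_block, orbit_young, word_apply_right h hk]
  sign := mul_one 1
  epsPoly_eq := by
    rw [epsPoly_right h hk, block_right_erase h hk, map_one, one_mul]

end KeySituation

/-! ### The generators as push-forwards. -/

/-- Since ε_ν = ε_K δ and |S_ν| = |K| ν_q, the expression (ν_q / |S_ν|) D_ν'(f ε_ν) equals D_ν'(δ f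
ε_K) / |K|, the push-forward of δ f. -/
theorem coinvRep_eq_pushforward (hφ : Function.Bijective (phi n)) {p q : ℤ} {x : glInf}
    (hx : x.1 = matrixUnit p q) {ν ν' : Comp n} {k : Fin n} (hk : word ν k = q)
    (hν : word ν' = Function.update (word ν) k p) {K : Subgroup (Equiv.Perm (Fin n))} {σ : ℂ}
    (S : PointStab K (young ν) k (block ν q) σ) (hK : K ≤ young ν) (hK' : K ≤ young ν')
    {δ : MvPolynomial (Fin n) ℂ} (hδ : epsPoly (young ν) = epsPoly K * δ) {y : inv K}
    (hy : (y : Coinv n) = toCoinv n δ) (f : inv (young ν)) :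
    coinvRep n hφ x (toSum ν f) = toSum ν' (pushforward hK' (y * pullback hK f)) := by
  refine coinvRep_matrixUnit hφ hx hk hν f _ ?_
  have hcard := S.card_eq
  have hq : (ν.1 q : ℂ) ≠ 0 := by
    rw [← card_block]
    exact Nat.cast_ne_zero.2 (Finset.card_ne_zero_of_mem S.self_mem)
  have h1 : ((y * pullback hK f : inv K) : Coinv n) * eps K = f * eps (young ν) := by
    rw [eps, eps, hδ, map_mul, ← hy]
    change (y : Coinv n) * (f : Coinv n) * _ = _
    ring
  have hKne := card_ne_zero K
  rw [(parab_young ν').coe_pushforward S.parabK, h1, hcard, card_block, Nat.cast_mul]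
  congr 1
  field_simp

end

end CoinvGl

open CoinvGl in
theorem mainTheorem4 (n : ℕ) :
    -- Poincaré duality, on which the push-forwards rest
    (PoincareDuality (⊥ : Subgroup (Equiv.Perm (Fin n))) ∧
      (∀ ν : Comp n, PoincareDuality (young ν)) ∧
      (∀ ν ν' : Comp n, PoincareDuality (young ν ⊓ young ν'))) ∧
    -- `φ` is an isomorphism, and the action is transported through it
    ∃ hφ : Function.Bijective (phi n),
      ∀ (i : ℤ) (ν ν' : Comp n), KeySituation i ν ν' →
      ∀ a b : ℕ, a = ν'.1 i → b = ν.1 (i + 1) →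
      ∀ k : Fin n, (k : ℕ) + 1 = partialSum ν i →
      ∃ x m m' : inv (young ν ⊓ young ν'),
        (x : Coinv n) = toCoinv n (MvPolynomial.X k) ∧
        (m : Coinv n) = toCoinv n
          (∏ l : Fin n with l < k ∧ (k : ℕ) ≤ l + a, (MvPolynomial.X l - MvPolynomial.X k)) ∧
        (m' : Coinv n) = toCoinv n
          (∏ l : Fin n with k < l ∧ (l : ℕ) ≤ k + b, (MvPolynomial.X k - MvPolynomial.X l)) ∧
        -- (i) the map `F_i : C_ν → C_ν'`
        (∀ f : inv (young ν), coinvRep n hφ (genF i) (toSum ν f) =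
          toSum ν' (pushforward inf_le_right (m * pullback inf_le_left f))) ∧
        (∃ g : inv (young ν ⊓ young ν') →ₗ[ℂ] inv (young ν'),
          IsUniqueModuleHom inf_le_right x (fun r =>
            (-1) ^ a * ∑ s ∈ Finset.range (a + 1), (-1) ^ s * elem ν' i s *
              compl ν' (i + 1) ((r : ℤ) - s + a - b)) g ∧
          ∀ f : inv (young ν), coinvRep n hφ (genF i) (toSum ν f) =
            toSum ν' (g (pullback inf_le_left f))) ∧
        -- (ii) the map `E_i : C_ν' → C_ν`
        (∀ f : inv (young ν'), coinvRep n hφ (genE i) (toSum ν' f) =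
          toSum ν (pushforward inf_le_left (m' * pullback inf_le_right f))) ∧
        (∃ g : inv (young ν ⊓ young ν') →ₗ[ℂ] inv (young ν),
          IsUniqueModuleHom inf_le_left x (fun r =>
            (-1) ^ a * ∑ s ∈ Finset.range (b + 1), (-1) ^ s * elem ν (i + 1) s *
              compl ν i ((r : ℤ) - s + b - a)) g ∧
          ∀ f : inv (young ν'), coinvRep n hφ (genE i) (toSum ν' f) =
            toSum ν (g (pullback inf_le_right f))) := by
  refine ⟨⟨parab_bot.poincareDuality, fun ν => (parab_young ν).poincareDuality,
    fun ν ν' => (parab_young_inf ν ν').poincareDuality⟩, phi_bijective n, ?_⟩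
  rintro i ν ν' h a b rfl rfl k hk
  have hl : (Finset.univ.filter fun l : Fin n => l < k ∧ (k : ℕ) ≤ l + ν'.1 i) = block ν' i := by
    ext l
    rw [← block_left_erase h hk, Finset.mem_erase, mem_block_left h hk, Finset.mem_filter,
      lt_iff_le_and_ne]
    simp only [Finset.mem_univ, true_and]
    tauto
  have hr : (Finset.univ.filter fun l : Fin n => k < l ∧ (l : ℕ) ≤ k + ν.1 (i + 1)) =
      block ν (i + 1) := by
    ext l
    rw [mem_block_right hk]
    simp
  have hK := parab_young_inf ν ν'
  have S := pointStab_left h hk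
  have S' := pointStab_right h hk
  have hx : ∀ w ∈ young ν ⊓ young ν',
      MvPolynomial.rename w (MvPolynomial.X k : MvPolynomial (Fin n) ℂ) = MvPolynomial.X k := by
    intro w hw
    rw [MvPolynomial.rename_X, ((S.mem_iff w).1 hw).2]
  have hm := fun w (hw : w ∈ young ν ⊓ young ν') =>
    rename_eq_of_epsPoly_eq hK (parab_young ν) inf_le_left (epsPoly_left h hk) hw
  have hm' := fun w (hw : w ∈ young ν ⊓ young ν') =>
    rename_eq_of_epsPoly_eq hK (parab_young ν') inf_le_right (epsPoly_right h hk) hw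
  have hF := fun f => coinvRep_eq_pushforward (phi_bijective n) (x := genF i) rfl
    (word_apply_left h hk) (word_eq_update h hk) S inf_le_left inf_le_right (epsPoly_left h hk)
    (y := ⟨_, toCoinv_mem_inv hm⟩) rfl f
  -- The same statement with the two compositions exchanged: lowering the letter at k from i + 1 to
  -- i turns the word of ν' back into that of ν.
  have hE := fun f => coinvRep_eq_pushforward (phi_bijective n) (x := genE i) rfl
    (word_apply_right h hk) (word_eq_update' h hk) S' inf_le_right inf_le_left
    (epsPoly_right h hk) (y := ⟨_, toCoinv_mem_inv hm'⟩) rfl f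
  refine ⟨⟨_, toCoinv_mem_inv hx⟩, ⟨_, toCoinv_mem_inv hm⟩, ⟨_, toCoinv_mem_inv hm'⟩, rfl,
    by rw [hl], by rw [hr], hF, ⟨_, S'.isUniqueModuleHom inf_le_right rfl rfl fun r => ?_, hF⟩,
    hE, ⟨_, S.isUniqueModuleHom inf_le_left rfl rfl fun r => ?_, hE⟩⟩
  -- Here the push-forward has sign 1, and (-1)^a arises from turning the x_l - x_k into x_k - x_l.
  · have hneg : (∏ l ∈ block ν' i, (MvPolynomial.X l - MvPolynomial.X k) :
        MvPolynomial (Fin n) ℂ) = ((-1 : ℂ) ^ ν'.1 i) •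
          ∏ l ∈ block ν' i, (MvPolynomial.X k - MvPolynomial.X l) := by
      rw [MvPolynomial.smul_eq_C_mul, map_pow, map_neg, map_one, ← card_block ν' i,
        ← Finset.prod_neg]
      simp
    rw [hneg, smul_mul_assoc, map_smul, map_smul, S'.toCoinv_ppush rfl h.2.1, map_one, one_mul,
      ← algebraMap_mul]
    simp
  -- Here the multiplier has the right orientation, and (-1)^a is the sign of the push-forward to
  -- C_ν.
  · rw [S.toCoinv_ppush rfl h.1]
    simp
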